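/- Let $\mathbb{Q}(v)$ be the field of rational functions in an indeterminate $v$. Let $\mathbf{U}=\mathbf{U}_v(\mathfrak{gl}_2)$ be the $\mathbb{Q}(v)$-algebra with generators $e,f,K_1^{\pm1},K_2^{\pm1}$ and relations $$K_1K_2=K_2K_1,\qquad K_iK_i^{-1}=K_i^{-1}K_i=1\ (i=1,2),$$ $$K_1eK_1^{-1}=ve,\quad K_1fK_1^{-1}=v^{-1}f,\quad K_2eK_2^{-1}=v^{-1}e,\quad K_2fK_2^{-1}=vf,$$ $$ef-fe=\frac{K_1K_2^{-1}-K_1^{-1}K_2}{v-v^{-1}}.$$ It is a bialgebra with comultiplication $K_i\mapsto K_i\otimes K_i$, $e\mapsto e\otimes 1+K_1K_2^{-1}\otimes e$, $f\mapsto f\otimes K_1^{-1}K_2+1\otimes f$ and counit $K_i\mapsto 1$, $e,f\mapsto 0$. Let $E=\mathbb{Q}(v)^2$ be the $\mathbf{U}$-module on which $$e\mapsto\begin{pmatrix}0&1\\0&0\end{pmatrix},\quad f\mapsto\begin{pmatrix}0&0\\1&0\end{pmatrix},\quad K_1\mapsto\begin{pmatrix}v&0\\0&1\end{pmatrix},\quad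 K_2\mapsto\begin{pmatrix}1&0\\0&v\end{pmatrix}.$$ For an integer $d\ge 0$ let $\rho_d:\mathbf{U}\to\operatorname{End}_{\mathbb{Q}(v)}(E^{\otimes d})$ be the representation on the $d$-th tensor power determined by the bialgebra structure (for $d=0$ it is given by the counit), and let the quantum Schur algebra $S_v(2,d)$ be the image of $\rho_d$. **Theorem.** For every integer $d\ge 0$, the $\mathbb{Q}(v)$-algebra $S_v(2,d)$ is isomorphic to the $\mathbb{Q}(v)$-algebra generated by $e,f,K_1^{\pm1}$ subject to the relations $$K_1K_1^{-1}=K_1^{-1}K_1=1,$$ $$K_1eK_1^{-1}=ve,\qquad K_1fK_1^{-1}=v^{-1}f,$$ $$ef-fe=\frac{v^{-d}K_1^2-v^dK_1^{-2}}{v-v^{-1}},$$ $$(K_1-1)(K_1-v)(K_1-v^2)\cdots(K_1-v^d)=0,$$ by an isomorphism under which $e,f,K_1^{\pm1}$ correspond to $\rho_d(e),\rho_d(f),\rho_d(K_1^{\pm1})$, and $v^dK_1^{-1}$ corresponds to $\rho_d(K_2)$. -/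

import Mathlib

open scoped TensorProduct

noncomputable section

namespace QSchur

/-- The field `ℚ(v)` of rational functions in one indeterminate over `ℚ`. -/
abbrev Qv : Type := RatFunc ℚ

/-- The indeterminate `v` of `ℚ(v)`. -/
abbrev v : Qv := RatFunc.X

theorem v_ne_zero : v ≠ 0 := RatFunc.X_ne_zero

/-! ### The quantized enveloping algebra of `gl₂` -/

/-- Generators of the quantized enveloping algebra of `gl₂`;
`K₁'` and `K₂'` stand for the inverses of `K₁` and `K₂`. -/
inductive UGen : Type
  | e | f | K₁ | K₁' | K₂ | K₂'

/-- A generator, as an element of the free `ℚ(v)`-algebra. -/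
abbrev ug (x : UGen) : FreeAlgebra Qv UGen := FreeAlgebra.ι Qv x

open UGen in
/-- The defining relations of the quantized enveloping algebra of `gl₂`. -/
inductive URel : FreeAlgebra Qv UGen → FreeAlgebra Qv UGen → Prop
  | K₁_K₂ : URel (ug K₁ * ug K₂) (ug K₂ * ug K₁)
  | K₁_inv : URel (ug K₁ * ug K₁') 1
  | inv_K₁ : URel (ug K₁' * ug K₁) 1
  | K₂_inv : URel (ug K₂ * ug K₂') 1
  | inv_K₂ : URel (ug K₂' * ug K₂) 1
  | K₁_e : URel (ug K₁ * ug e * ug K₁') (v • ug e)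
  | K₁_f : URel (ug K₁ * ug f * ug K₁') (v⁻¹ • ug f)
  | K₂_e : URel (ug K₂ * ug e * ug K₂') (v⁻¹ • ug e)
  | K₂_f : URel (ug K₂ * ug f * ug K₂') (v • ug f)
  | e_f : URel (ug e * ug f - ug f * ug e)
      ((v - v⁻¹)⁻¹ • (ug K₁ * ug K₂' - ug K₁' * ug K₂))

/-- The quantized enveloping algebra `U = U_v(gl₂)` over `ℚ(v)`. -/
abbrev U : Type := RingQuot URel

namespace U

/-- The image of a generator in `U`. -/
def gen (x : UGen) : U := RingQuot.mkAlgHom Qv URel (ug x)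

/-- The element `e` of `U`. -/
abbrev e : U := gen UGen.e
/-- The element `f` of `U`. -/
abbrev f : U := gen UGen.f
/-- The element `K₁` of `U`. -/
abbrev K₁ : U := gen UGen.K₁
/-- The inverse of `K₁` in `U`. -/
abbrev K₁' : U := gen UGen.K₁'
/-- The element `K₂` of `U`. -/
abbrev K₂ : U := gen UGen.K₂
/-- The inverse of `K₂` in `U`. -/
abbrev K₂' : U := gen UGen.K₂'

theorem K₁_mul_K₂ : K₁ * K₂ = K₂ * K₁ := by
  simpa [gen] using RingQuot.mkAlgHom_rel Qv URel.K₁_K₂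
theorem K₁_mul_inv : K₁ * K₁' = 1 := by
  simpa [gen] using RingQuot.mkAlgHom_rel Qv URel.K₁_inv
theorem inv_mul_K₁ : K₁' * K₁ = 1 := by
  simpa [gen] using RingQuot.mkAlgHom_rel Qv URel.inv_K₁
theorem K₂_mul_inv : K₂ * K₂' = 1 := by
  simpa [gen] using RingQuot.mkAlgHom_rel Qv URel.K₂_inv
theorem inv_mul_K₂ : K₂' * K₂ = 1 := by
  simpa [gen] using RingQuot.mkAlgHom_rel Qv URel.inv_K₂
theorem K₁_conj_e : K₁ * e * K₁' = v • e := by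
  simpa [gen] using RingQuot.mkAlgHom_rel Qv URel.K₁_e
theorem K₁_conj_f : K₁ * f * K₁' = v⁻¹ • f := by
  simpa [gen] using RingQuot.mkAlgHom_rel Qv URel.K₁_f
theorem K₂_conj_e : K₂ * e * K₂' = v⁻¹ • e := by
  simpa [gen] using RingQuot.mkAlgHom_rel Qv URel.K₂_e
theorem K₂_conj_f : K₂ * f * K₂' = v • f := by
  simpa [gen] using RingQuot.mkAlgHom_rel Qv URel.K₂_f
theorem e_f_comm : e * f - f * e = (v - v⁻¹)⁻¹ • (K₁ * K₂' - K₁' * K₂) := by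
  simpa [gen] using RingQuot.mkAlgHom_rel Qv URel.e_f

/-- Six elements of a `ℚ(v)`-algebra satisfy the defining relations of `U`. -/
structure Compatible {A : Type*} [Ring A] [Algebra Qv A] (g : UGen → A) : Prop where
  K₁_K₂ : g .K₁ * g .K₂ = g .K₂ * g .K₁
  K₁_inv : g .K₁ * g .K₁' = 1
  inv_K₁ : g .K₁' * g .K₁ = 1
  K₂_inv : g .K₂ * g .K₂' = 1
  inv_K₂ : g .K₂' * g .K₂ = 1
  K₁_e : g .K₁ * g .e * g .K₁' = v • g .e
  K₁_f : g .K₁ * g .f * g .K₁' = v⁻¹ • g .f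
  K₂_e : g .K₂ * g .e * g .K₂' = v⁻¹ • g .e
  K₂_f : g .K₂ * g .f * g .K₂' = v • g .f
  e_f : g .e * g .f - g .f * g .e =
    (v - v⁻¹)⁻¹ • (g .K₁ * g .K₂' - g .K₁' * g .K₂)

/-- The algebra homomorphism out of `U` with prescribed values on the generators. -/
def lift {A : Type*} [Ring A] [Algebra Qv A] (g : UGen → A) (h : Compatible g) :
    U →ₐ[Qv] A :=
  RingQuot.liftAlgHom Qv ⟨FreeAlgebra.lift Qv g, by
    intro x y hxy
    cases hxy
    · simpa using h.K₁_K₂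
    · simpa using h.K₁_inv
    · simpa using h.inv_K₁
    · simpa using h.K₂_inv
    · simpa using h.inv_K₂
    · simpa using h.K₁_e
    · simpa using h.K₁_f
    · simpa using h.K₂_e
    · simpa using h.K₂_f
    · simpa using h.e_f⟩

@[simp] theorem lift_gen {A : Type*} [Ring A] [Algebra Qv A] (g : UGen → A)
    (h : Compatible g) (x : UGen) : lift g h (gen x) = g x := by
  simp [lift, gen]

theorem algHom_ext {A : Type*} [Semiring A] [Algebra Qv A] {φ ψ : U →ₐ[Qv] A}
    (h : ∀ x, φ (gen x) = ψ (gen x)) : φ = ψ := by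
  apply RingQuot.ringQuot_ext'
  apply FreeAlgebra.hom_ext
  funext x
  exact h x

/-! ### The bialgebra structure -/

/-- The comultiplication on generators: `K_i ↦ K_i ⊗ K_i`, and with `K = K₁ K₂⁻¹`,
`e ↦ e ⊗ 1 + K ⊗ e` and `f ↦ f ⊗ K⁻¹ + 1 ⊗ f`. -/
def comulGen : UGen → U ⊗[Qv] U
  | .e => e ⊗ₜ 1 + (K₁ * K₂') ⊗ₜ e
  | .f => f ⊗ₜ (K₁' * K₂) + 1 ⊗ₜ f
  | .K₁ => K₁ ⊗ₜ K₁
  | .K₁' => K₁' ⊗ₜ K₁'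
  | .K₂ => K₂ ⊗ₜ K₂
  | .K₂' => K₂' ⊗ₜ K₂'

/-- The counit on generators. -/
def counitGen : UGen → Qv
  | .e => 0
  | .f => 0
  | .K₁ => 1
  | .K₁' => 1
  | .K₂ => 1
  | .K₂' => 1

theorem K₁_e : K₁ * e = v • (e * K₁) := by
  have := congrArg (· * K₁) K₁_conj_e
  simpa [mul_assoc, inv_mul_K₁] using this
theorem K₁_f : K₁ * f = v⁻¹ • (f * K₁) := by
  have := congrArg (· * K₁) K₁_conj_f
  simpa [mul_assoc, inv_mul_K₁] using this
theorem K₂_e : K₂ * e = v⁻¹ • (e * K₂) := by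
  have := congrArg (· * K₂) K₂_conj_e
  simpa [mul_assoc, inv_mul_K₂] using this
theorem K₂_f : K₂ * f = v • (f * K₂) := by
  have := congrArg (· * K₂) K₂_conj_f
  simpa [mul_assoc, inv_mul_K₂] using this
theorem K₁'_e : K₁' * e = v⁻¹ • (e * K₁') := by
  have := congrArg (fun x => v⁻¹ • (K₁' * x)) K₁_conj_e
  simpa [← mul_assoc, inv_mul_K₁, smul_smul, v_ne_zero] using this.symm
theorem K₂'_f : K₂' * f = v⁻¹ • (f * K₂') := by
  have := congrArg (fun x => v⁻¹ • (K₂' * x)) K₂_conj_f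
  simpa [← mul_assoc, inv_mul_K₂, smul_smul, v_ne_zero] using this.symm
theorem K₁_K₂' : K₁ * K₂' = K₂' * K₁ := by
  have := congrArg (fun x => K₂' * x * K₂') K₁_mul_K₂
  simp only [mul_assoc, K₂_mul_inv, mul_one] at this
  rw [← mul_assoc K₂' K₂, inv_mul_K₂, one_mul] at this
  exact this.symm
theorem K₁'_K₂ : K₁' * K₂ = K₂ * K₁' := by
  have := congrArg (fun x => K₁' * x * K₁') K₁_mul_K₂
  simp only [mul_assoc, K₁_mul_inv, mul_one] at this
  rw [← mul_assoc K₁' K₁, inv_mul_K₁, one_mul] at this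
  exact this.symm
theorem K₁'_K₂' : K₁' * K₂' = K₂' * K₁' := by
  have := congrArg (fun x => K₁' * x * K₁') K₁_K₂'
  simp only [mul_assoc, K₁_mul_inv, mul_one] at this
  rw [← mul_assoc K₁' K₁, inv_mul_K₁, one_mul] at this
  exact this.symm

theorem K_mul_Kinv : K₁ * K₂' * (K₁' * K₂) = 1 := by
  rw [mul_assoc, ← mul_assoc K₂' K₁', ← K₁'_K₂', mul_assoc K₁', inv_mul_K₂, mul_one, K₁_mul_inv]
theorem Kinv_mul_K : K₁' * K₂ * (K₁ * K₂') = 1 := by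
  rw [mul_assoc, ← mul_assoc K₂ K₁, ← K₁_mul_K₂, mul_assoc K₁, K₂_mul_inv, mul_one, inv_mul_K₁]
theorem K_f : K₁ * K₂' * f = (v⁻¹ * v⁻¹) • (f * (K₁ * K₂')) := by
  rw [mul_assoc, K₂'_f, mul_smul_comm, ← mul_assoc, K₁_f, smul_mul_assoc, smul_smul, mul_assoc]
theorem Kinv_e : K₁' * K₂ * e = (v⁻¹ * v⁻¹) • (e * (K₁' * K₂)) := by
  rw [mul_assoc, K₂_e, mul_smul_comm, ← mul_assoc, K₁'_e, smul_mul_assoc, smul_smul, mul_assoc]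

theorem comulGen_compatible : Compatible comulGen where
  K₁_K₂ := by simp [comulGen, K₁_mul_K₂]
  K₁_inv := by simp [comulGen, K₁_mul_inv, Algebra.TensorProduct.one_def]
  inv_K₁ := by simp [comulGen, inv_mul_K₁, Algebra.TensorProduct.one_def]
  K₂_inv := by simp [comulGen, K₂_mul_inv, Algebra.TensorProduct.one_def]
  inv_K₂ := by simp [comulGen, inv_mul_K₂, Algebra.TensorProduct.one_def]
  K₁_e := by
    have h : K₁ * (K₁ * K₂') * K₁' = K₁ * K₂' := by
      rw [K₁_K₂', ← mul_assoc, K₁_K₂', mul_assoc, K₁_mul_inv, mul_one]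
    simp [comulGen, mul_add, add_mul, K₁_mul_inv, K₁_conj_e, h, ← TensorProduct.smul_tmul']
  K₁_f := by
    have h : K₁ * (K₁' * K₂) * K₁' = K₁' * K₂ := by
      rw [← mul_assoc, K₁_mul_inv, one_mul, K₁'_K₂]
    simp [comulGen, mul_add, add_mul, K₁_mul_inv, K₁_conj_f, h, ← TensorProduct.smul_tmul']
  K₂_e := by
    have h : K₂ * (K₁ * K₂') * K₂' = K₁ * K₂' := by
      rw [← mul_assoc, ← K₁_mul_K₂, mul_assoc K₁, K₂_mul_inv, mul_one]
    simp [comulGen, mul_add, add_mul, K₂_mul_inv, K₂_conj_e, h, ← TensorProduct.smul_tmul']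
  K₂_f := by
    have h : K₂ * (K₁' * K₂) * K₂' = K₁' * K₂ := by
      rw [← mul_assoc, mul_assoc, K₂_mul_inv, mul_one, K₁'_K₂]
    simp [comulGen, mul_add, add_mul, K₂_mul_inv, K₂_conj_f, h, ← TensorProduct.smul_tmul']
  e_f := by
    have h1 : comulGen .e * comulGen .f - comulGen .f * comulGen .e =
        (e * f - f * e) ⊗ₜ (K₁' * K₂) + (K₁ * K₂') ⊗ₜ (e * f - f * e) := by
      simp only [comulGen, mul_add, add_mul, Algebra.TensorProduct.tmul_mul_tmul, mul_one,
        one_mul, K_f, Kinv_e, TensorProduct.sub_tmul, TensorProduct.tmul_sub,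
        TensorProduct.smul_tmul]
      abel
    rw [h1, e_f_comm]
    simp only [comulGen, Algebra.TensorProduct.tmul_mul_tmul, TensorProduct.sub_tmul, TensorProduct.tmul_sub, smul_sub]
    simp only [TensorProduct.smul_tmul', TensorProduct.tmul_smul]
    abel

theorem counitGen_compatible : Compatible counitGen := by
  constructor <;> simp [counitGen]

/-- The comultiplication `Δ : U → U ⊗ U`. -/
def Δ : U →ₐ[Qv] U ⊗[Qv] U := lift comulGen comulGen_compatible

/-- The counit of `U`. -/
def ε : U →ₐ[Qv] Qv := lift counitGen counitGen_compatible

/-- The bialgebra structure of `U`. -/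
instance : Bialgebra Qv U := Bialgebra.ofAlgHom Δ ε
  (by
    apply algHom_ext
    intro x
    cases x <;> simp [Δ, comulGen, TensorProduct.add_tmul, TensorProduct.tmul_add,
      Algebra.TensorProduct.one_def, K₁_K₂', K₁'_K₂, add_assoc])
  (by
    apply algHom_ext
    intro x
    cases x <;> simp [Δ, ε, comulGen, counitGen])
  (by
    apply algHom_ext
    intro x
    cases x <;> simp [Δ, ε, comulGen, counitGen])

end U

/-! ### The natural module, its tensor powers and the quantum Schur algebra -/

/-- The natural two-dimensional module, with its standard basis. -/
abbrev E : Type := Fin 2 → Qv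

/-- The matrices by which the generators of `U` act on `E`. -/
def natGen : UGen → Matrix (Fin 2) (Fin 2) Qv
  | .e => !![0, 1; 0, 0]
  | .f => !![0, 0; 1, 0]
  | .K₁ => !![v, 0; 0, 1]
  | .K₁' => !![v⁻¹, 0; 0, 1]
  | .K₂ => !![1, 0; 0, v]
  | .K₂' => !![1, 0; 0, v⁻¹]

theorem v_sub_inv_ne_zero : v - v⁻¹ ≠ 0 := by
  intro h
  have h2 : (RatFunc.X : RatFunc ℚ) ^ 2 = 1 := by
    have := congrArg (v * ·) h
    simp only [mul_sub, mul_zero, mul_inv_cancel₀ v_ne_zero] at this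
    rw [pow_two]; exact sub_eq_zero.mp this
  have h3 : (Polynomial.X : Polynomial ℚ) ^ 2 = 1 := by
    apply RatFunc.algebraMap_injective ℚ
    simpa using h2
  have h4 := congrArg (Polynomial.eval 2) h3
  norm_num at h4

theorem natGen_compatible : U.Compatible natGen := by
  have h := v_ne_zero
  have h' := v_sub_inv_ne_zero
  constructor <;> ext i j <;> fin_cases i <;> fin_cases j <;>
    simp [natGen, Matrix.mul_apply, Fin.sum_univ_two, h]
  · exact (inv_mul_cancel₀ h').symm
  · rw [← neg_sub v v⁻¹, mul_neg, inv_mul_cancel₀ h']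

/-- The natural representation `ρ : U → End(E)`. -/
def ρ : U →ₐ[Qv] Module.End Qv E :=
  (Matrix.toLinAlgEquiv' : Matrix (Fin 2) (Fin 2) Qv ≃ₐ[Qv] Module.End Qv E).toAlgHom.comp
    (U.lift natGen natGen_compatible)

/-- The canonical identification `E^{⊗ d} ⊗ E = E^{⊗ (d + 1)}`. -/
def tensorPowSucc (d : ℕ) : (⨂[Qv]^d E) ⊗[Qv] E ≃ₗ[Qv] ⨂[Qv]^(d + 1) E :=
  (TensorProduct.congr (LinearEquiv.refl Qv (⨂[Qv]^d E))
    (PiTensorProduct.subsingletonEquiv (R := Qv) (s := fun _ : Fin 1 => E) 0).symm).trans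
    TensorPower.mulEquiv

/-- The representation `ρ_d : U → End(E^{⊗ d})` given by the bialgebra structure: `U` acts on
`E^{⊗ 0} = ℚ(v)` through the counit, and on `E^{⊗ (d + 1)} = E^{⊗ d} ⊗ E` through the
comultiplication. -/
def ρpow : (d : ℕ) → U →ₐ[Qv] Module.End Qv (⨂[Qv]^d E)
  | 0 => (Algebra.ofId Qv (Module.End Qv (⨂[Qv]^0 E))).comp (Bialgebra.counitAlgHom Qv U)
  | d + 1 =>
    ((tensorPowSucc d).conjAlgEquiv Qv).toAlgHom.comp
      ((Module.endTensorEndAlgHom (R := Qv) (A := Qv) (S := Qv) (M := ⨂[Qv]^d E) (N := E)).comp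
        ((Algebra.TensorProduct.map (ρpow d) ρ).comp (Bialgebra.comulAlgHom Qv U)))

/-- The quantum Schur algebra `S_v(2,d)`: the image of `ρ_d`. -/
def schur (d : ℕ) : Subalgebra Qv (Module.End Qv (⨂[Qv]^d E)) := (ρpow d).range

/-- The canonical surjection `U → S_v(2,d)`. -/
def toSchur (d : ℕ) : U →ₐ[Qv] schur d := (ρpow d).rangeRestrict

/-! ### The algebra given by generators and relations -/

/-- The generators `e`, `f`, `K₁`, `K₁⁻¹` (the last written `K₁'`). -/
inductive PGen : Type
  | e | f | K₁ | K₁'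

/-- A generator, as an element of the free `ℚ(v)`-algebra. -/
abbrev pg (x : PGen) : FreeAlgebra Qv PGen := FreeAlgebra.ι Qv x

open PGen in
/-- The relations imposed on `e`, `f`, `K₁`, `K₁⁻¹`. The last one is
`(K₁ - 1)(K₁ - v) ⋯ (K₁ - v^d) = 0`. -/
inductive PRel (d : ℕ) : FreeAlgebra Qv PGen → FreeAlgebra Qv PGen → Prop
  | K₁_inv : PRel d (pg K₁ * pg K₁') 1
  | inv_K₁ : PRel d (pg K₁' * pg K₁) 1
  | K₁_e : PRel d (pg K₁ * pg e * pg K₁') (v • pg e)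
  | K₁_f : PRel d (pg K₁ * pg f * pg K₁') (v⁻¹ • pg f)
  | e_f : PRel d (pg e * pg f - pg f * pg e)
      ((v - v⁻¹)⁻¹ • ((v ^ d)⁻¹ • pg K₁ ^ 2 - v ^ d • pg K₁' ^ 2))
  | K₁_min : PRel d
      ((List.range (d + 1)).map fun i => pg K₁ - algebraMap Qv (FreeAlgebra Qv PGen) (v ^ i)).prod 0

/-- The `ℚ(v)`-algebra with generators `PGen` and relations `PRel d`. -/
abbrev Presented (d : ℕ) : Type := RingQuot (PRel d)

/-- The image of a generator in the presented algebra. -/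
def Presented.gen (d : ℕ) (x : PGen) : Presented d := RingQuot.mkAlgHom Qv (PRel d) (pg x)

end QSchur

end

open scoped TensorProduct

noncomputable section

namespace QSchur

/-! ### Powers of the indeterminate -/

/-! Write `A` for the presented algebra. On tensor powers the weight vectors span, `K₁ K₂` acts as
`v ^ d` and `K₁` has its eigenvalues among `1, v, …, v ^ d`; hence `A` maps onto the Schur algebra
(`range_toEnd`). The content is faithfulness (`toEnd_injective`), obtained here with neither a
dimension count nor complete reducibility.

The Casimir element is central and acts on a vector of weight `n` killed by `e` through a scalar
which, `v` not being a root of unity, determines `n` up to `n ↦ d - 1 - n` (`casimirScalar_eq`). The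
polynomial relation for `K₁` bounds the weights, so any weight vector can be pushed by `e` or `f` to
the end of its string. Comparing Casimir scalars there gives, in every module satisfying the
relations, that highest weights have `2n ≥ d` (`le_of_highest`) and that `e f` is injective on
weights `2n > d` (`eq_zero_of_e_f`). This applies to `E^{⊗ d}` and to `A` under left multiplication,
and under right multiplication with `e` and `f` exchanged.

A nonzero kernel `J` is a two-sided ideal, so it contains some `x ≠ 0` with `e x = 0 = x f` that is
a weight vector on both sides. Dominance and centrality of the Casimir element force both weights to
be the same `i`, and then `x = f u + a p_i`, with `p_i` the weight idempotent and `u` of left weight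
`i + 1` (`exists_eq_f_mul_add`). Apply `x` to a highest weight vector of weight `i` in `E^{⊗ d}`
(`exists_highest_vector`): injectivity of `e f` gives `a = 0`. Then `e f u = 0` in `A`, so `u = 0`
and `x = 0`, a contradiction. -/

theorem v_pow_eq_one {n : ℕ} (h : v ^ n = 1) : n = 0 := by
  have h3 : (Polynomial.X : Polynomial ℚ) ^ n = 1 := by
    apply RatFunc.algebraMap_injective ℚ
    simpa using h
  simpa using congrArg Polynomial.natDegree h3

theorem v_zpow_eq_one {n : ℤ} (h : v ^ n = 1) : n = 0 := by
  obtain ⟨k, rfl | rfl⟩ := n.eq_nat_or_neg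
  · simpa using v_pow_eq_one (by simpa using h)
  · simpa using v_pow_eq_one (n := k) (by simpa using h)

theorem v_zpow_injective : Function.Injective (fun n : ℤ => v ^ n) := by
  intro m n h
  have h1 : v ^ (m - n) = 1 := by
    rw [zpow_sub₀ v_ne_zero]
    exact (div_eq_one_iff_eq (zpow_ne_zero _ v_ne_zero)).2 h
  exact sub_eq_zero.1 (v_zpow_eq_one h1)

theorem v_pow_injective : Function.Injective (fun n : ℕ => v ^ n) := by
  intro m n h
  exact_mod_cast v_zpow_injective (a₁ := (m : ℤ)) (a₂ := n) (by simpa using h)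

/-- The scalar by which the Casimir element acts on a highest weight vector of weight `n`. -/
def casimirScalar (d : ℕ) (n : ℤ) : Qv := v ^ (2 * n - d + 1) + v ^ (-(2 * n - d + 1))

/-- The equation `v ^ m + v ^ (-m) = v ^ n + v ^ (-n)` factors as `(v ^ m - v ^ n) (v ^ (m + n) - 1)
= 0`. The second solution is the reflection of weights. -/
theorem casimirScalar_eq {d : ℕ} {a b : ℤ} (h : casimirScalar d a = casimirScalar d b) :
    a = b ∨ a + b = d - 1 := by
  unfold casimirScalar at h
  obtain ⟨m, hm⟩ : ∃ m, 2 * a - d + 1 = m := ⟨_, rfl⟩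
  obtain ⟨n, hn⟩ : ∃ n, 2 * b - d + 1 = n := ⟨_, rfl⟩
  rw [hm, hn] at h
  have hprod : (v ^ m - v ^ n) * (v ^ (m + n) - 1) = 0 := by
    have e1 : v ^ m ≠ 0 := zpow_ne_zero _ v_ne_zero
    have e2 : v ^ n ≠ 0 := zpow_ne_zero _ v_ne_zero
    rw [zpow_neg, zpow_neg] at h
    rw [zpow_add₀ v_ne_zero]
    field_simp at h
    linear_combination h
  rcases mul_eq_zero.1 hprod with h1 | h1
  · left
    have := v_zpow_injective (sub_eq_zero.1 h1)
    omega
  · right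
    have := v_zpow_eq_one (sub_eq_zero.1 h1)
    omega

/-! ### Families satisfying the relations of the presentation -/

/-- Four elements of a `ℚ(v)`-algebra satisfy the relations `PRel d`. -/
structure PCompatible (d : ℕ) {A : Type*} [Ring A] [Algebra Qv A] (g : PGen → A) : Prop where
  K₁_inv : g .K₁ * g .K₁' = 1
  inv_K₁ : g .K₁' * g .K₁ = 1
  K₁_conj_e : g .K₁ * g .e * g .K₁' = v • g .e
  K₁_conj_f : g .K₁ * g .f * g .K₁' = v⁻¹ • g .f
  e_f : g .e * g .f - g .f * g .e =
    (v - v⁻¹)⁻¹ • ((v ^ d)⁻¹ • g .K₁ ^ 2 - v ^ d • g .K₁' ^ 2)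
  K₁_min : ((List.range (d + 1)).map fun i => g .K₁ - algebraMap Qv A (v ^ i)).prod = 0

/-- The Casimir element attached to a family of four elements. -/
def casimir (d : ℕ) {A : Type*} [Ring A] [Algebra Qv A] (g : PGen → A) : A :=
  (v - v⁻¹) ^ 2 • (g .f * g .e) + (v * (v ^ d)⁻¹) • g .K₁ ^ 2 + (v⁻¹ * v ^ d) • g .K₁' ^ 2

namespace PCompatible

/-! ### Commutation rules, centrality of the Casimir element, weight idempotents. -/

section Algebra

variable {d : ℕ} {A : Type*} [Ring A] [Algebra Qv A] {g : PGen → A}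

theorem K₁_e (h : PCompatible d g) : g .K₁ * g .e = v • (g .e * g .K₁) := by
  have := congrArg (· * g .K₁) h.K₁_conj_e
  simpa [mul_assoc, h.inv_K₁] using this

theorem K₁_f (h : PCompatible d g) : g .K₁ * g .f = v⁻¹ • (g .f * g .K₁) := by
  have := congrArg (· * g .K₁) h.K₁_conj_f
  simpa [mul_assoc, h.inv_K₁] using this

theorem K₁'_e (h : PCompatible d g) : g .K₁' * g .e = v⁻¹ • (g .e * g .K₁') := by
  have := congrArg (fun x => v⁻¹ • (g .K₁' * x)) h.K₁_conj_e
  simpa [← mul_assoc, h.inv_K₁, smul_smul, v_ne_zero] using this.symm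

theorem K₁'_f (h : PCompatible d g) : g .K₁' * g .f = v • (g .f * g .K₁') := by
  have := congrArg (fun x => v • (g .K₁' * x)) h.K₁_conj_f
  simpa [← mul_assoc, h.inv_K₁, smul_smul, v_ne_zero] using this.symm

theorem K₁_sq_e (h : PCompatible d g) : g .K₁ ^ 2 * g .e = v ^ 2 • (g .e * g .K₁ ^ 2) := by
  rw [pow_two, mul_assoc, h.K₁_e, mul_smul_comm, ← mul_assoc, h.K₁_e, smul_mul_assoc, smul_smul,
    mul_assoc, pow_two]

theorem K₁_sq_f (h : PCompatible d g) : g .K₁ ^ 2 * g .f = (v⁻¹) ^ 2 • (g .f * g .K₁ ^ 2) := by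
  rw [pow_two, mul_assoc, h.K₁_f, mul_smul_comm, ← mul_assoc, h.K₁_f, smul_mul_assoc, smul_smul,
    mul_assoc, pow_two]

theorem K₁'_sq_e (h : PCompatible d g) :
    g .K₁' ^ 2 * g .e = (v⁻¹) ^ 2 • (g .e * g .K₁' ^ 2) := by
  rw [pow_two, mul_assoc, h.K₁'_e, mul_smul_comm, ← mul_assoc, h.K₁'_e, smul_mul_assoc, smul_smul,
    mul_assoc, pow_two]

theorem K₁'_sq_f (h : PCompatible d g) : g .K₁' ^ 2 * g .f = v ^ 2 • (g .f * g .K₁' ^ 2) := by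
  rw [pow_two, mul_assoc, h.K₁'_f, mul_smul_comm, ← mul_assoc, h.K₁'_f, smul_mul_assoc, smul_smul,
    mul_assoc, pow_two]

theorem e_mul_f (h : PCompatible d g) : g .e * g .f =
    g .f * g .e + (v - v⁻¹)⁻¹ • ((v ^ d)⁻¹ • g .K₁ ^ 2 - v ^ d • g .K₁' ^ 2) := by
  rw [← h.e_f]; abel

/-- With both forms at hand, commutation with `e` is immediate: the `e f` form times `e` and `e`
times the `f e` form share the term `e f e`. Commutation with `f` is symmetric. -/
theorem casimir_eq (h : PCompatible d g) : casimir d g =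
    (v - v⁻¹) ^ 2 • (g .e * g .f) + (v⁻¹ * (v ^ d)⁻¹) • g .K₁ ^ 2
      + (v * v ^ d) • g .K₁' ^ 2 := by
  have hc := v_sub_inv_ne_zero
  have hs : (v - v⁻¹) ^ 2 * (v - v⁻¹)⁻¹ = v - v⁻¹ := by field_simp
  rw [h.e_mul_f, casimir, smul_add, smul_smul ((v - v⁻¹) ^ 2), hs]
  have hx : (v * (v ^ d)⁻¹) • g .K₁ ^ 2 =
      ((v - v⁻¹) * (v ^ d)⁻¹) • g .K₁ ^ 2 + (v⁻¹ * (v ^ d)⁻¹) • g .K₁ ^ 2 := by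
    rw [← add_smul]; congr 1; ring
  have hy : (v * v ^ d) • g .K₁' ^ 2 =
      ((v - v⁻¹) * v ^ d) • g .K₁' ^ 2 + (v⁻¹ * v ^ d) • g .K₁' ^ 2 := by
    rw [← add_smul]; congr 1; ring
  rw [hx, hy, smul_sub, smul_smul, smul_smul]
  abel

theorem commute_casimir_e (h : PCompatible d g) : Commute (casimir d g) (g .e) := by
  have hv := v_ne_zero
  unfold Commute SemiconjBy
  conv_lhs => rw [h.casimir_eq]
  rw [casimir]
  simp only [mul_add, add_mul, smul_mul_assoc, mul_smul_comm, h.K₁_sq_e, h.K₁'_sq_e, smul_smul,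
    mul_assoc]
  refine congrArg₂ _ (congrArg₂ _ rfl (congrArg₂ _ ?_ rfl)) (congrArg₂ _ ?_ rfl) <;> field_simp

theorem commute_casimir_f (h : PCompatible d g) : Commute (casimir d g) (g .f) := by
  have hv := v_ne_zero
  unfold Commute SemiconjBy
  conv_rhs => rw [h.casimir_eq]
  rw [casimir]
  simp only [mul_add, add_mul, smul_mul_assoc, mul_smul_comm, h.K₁_sq_f, h.K₁'_sq_f, smul_smul,
    mul_assoc]
  refine congrArg₂ _ (congrArg₂ _ rfl (congrArg₂ _ ?_ rfl)) (congrArg₂ _ ?_ rfl) <;> field_simp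

theorem commute_K₁_K₁' (h : PCompatible d g) : Commute (g .K₁) (g .K₁') :=
  h.K₁_inv.trans h.inv_K₁.symm

theorem commute_casimir_K₁ (h : PCompatible d g) : Commute (casimir d g) (g .K₁) := by
  have hv := v_ne_zero
  have h1 : Commute (g .f * g .e) (g .K₁) := by
    refine Eq.symm ?_
    rw [← mul_assoc, h.K₁_f, smul_mul_assoc, mul_assoc, h.K₁_e, mul_smul_comm, smul_smul,
      inv_mul_cancel₀ hv, one_smul, mul_assoc]
  exact ((h1.smul_left _).add_left (((Commute.refl _).pow_left 2).smul_left _)).add_left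
    ((h.commute_K₁_K₁'.symm.pow_left 2).smul_left _)

theorem commute_casimir_K₁' (h : PCompatible d g) : Commute (casimir d g) (g .K₁') := by
  have h1 := congrArg (fun x => g .K₁' * x * g .K₁') h.commute_casimir_K₁.eq
  simp only [mul_assoc, h.K₁_inv, mul_one] at h1
  rw [← mul_assoc (g .K₁') (g .K₁), h.inv_K₁, one_mul] at h1
  exact h1.symm

theorem commute_casimir_gen (h : PCompatible d g) (x : PGen) : Commute (casimir d g) (g x) := by
  cases x
  · exact h.commute_casimir_e
  · exact h.commute_casimir_f
  · exact h.commute_casimir_K₁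
  · exact h.commute_casimir_K₁'

/-- There is a system of orthogonal idempotents projecting to the weight spaces. -/
theorem exists_projectors (h : PCompatible d g) : ∃ p : ℕ → A,
    (∀ i, g .K₁ * p i = v ^ i • p i) ∧ (∀ i, p i * g .K₁ = v ^ i • p i) ∧
    ∑ i ∈ Finset.range (d + 1), p i = 1 := by
  classical
  -- Lagrange interpolation at the distinct nodes `v ^ i`. Outside `0, …, d` the value is `0`, so
  -- the eigenvector identities hold for every natural `i`.
  let P : ℕ → Polynomial Qv := fun i =>
    if i ∈ Finset.range (d + 1) then Lagrange.basis (Finset.range (d + 1)) (fun i => v ^ i) i else 0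
  have hnodal : Polynomial.aeval (g .K₁) (Lagrange.nodal (Finset.range (d + 1)) fun i => v ^ i)
      = 0 := by
    rw [← h.K₁_min, Lagrange.nodal, Finset.prod_eq_multiset_prod, Finset.range_val,
      Multiset.range, Multiset.map_coe, Multiset.prod_coe, map_list_prod, List.map_map]
    congr 2
    funext i
    simp
  have hP : ∀ i, Polynomial.aeval (g .K₁) ((Polynomial.X - Polynomial.C (v ^ i)) * P i) = 0 := by
    intro i
    by_cases hi : i ∈ Finset.range (d + 1)
    · have : (Polynomial.X - Polynomial.C (v ^ i)) * P i =
          Polynomial.C (Lagrange.nodalWeight (Finset.range (d + 1)) (fun i => v ^ i) i) *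
            Lagrange.nodal (Finset.range (d + 1)) (fun i => v ^ i) := by
        simp only [P, if_pos hi]
        rw [Lagrange.basis_eq_prod_sub_inv_mul_nodal_div hi, ← Lagrange.nodal_erase_eq_nodal_div hi,
          Lagrange.nodal_eq_mul_nodal_erase hi]
        ring
      rw [this, map_mul, hnodal, mul_zero]
    · simp only [P, if_neg hi, mul_zero, map_zero]
  refine ⟨fun i => Polynomial.aeval (g .K₁) (P i), fun i => ?_, fun i => ?_, ?_⟩
  · have := hP i
    rw [map_mul, map_sub, Polynomial.aeval_X, Polynomial.aeval_C, sub_mul, sub_eq_zero] at this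
    rw [this, Algebra.smul_def]
  · have := hP i
    rw [mul_comm, map_mul, map_sub, Polynomial.aeval_X, Polynomial.aeval_C, mul_sub,
      sub_eq_zero] at this
    rw [this, Algebra.smul_def, Algebra.commutes]
  · rw [← map_sum, Finset.sum_congr rfl fun i hi => if_pos hi, Lagrange.sum_basis, map_one]
    · exact v_pow_injective.injOn
    · simp

end Algebra

/-! ### Weight strings and the Casimir scalar in a module. -/

section Module

variable {d : ℕ} {M : Type*} [AddCommGroup M] [Module Qv M] {g : PGen → Module.End Qv M}

theorem K₁'_apply (h : PCompatible d g) {n : ℤ} {x : M} (hx : g .K₁ x = v ^ n • x) :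
    g .K₁' x = v ^ (-n) • x := by
  have h1 : g .K₁' (g .K₁ x) = x := by
    rw [← Module.End.mul_apply, h.inv_K₁, Module.End.one_apply]
  rw [hx, map_smul] at h1
  rw [zpow_neg, eq_inv_smul_iff₀ (zpow_ne_zero _ v_ne_zero), h1]

theorem K₁_e_apply (h : PCompatible d g) {n : ℤ} {x : M} (hx : g .K₁ x = v ^ n • x) :
    g .K₁ (g .e x) = v ^ (n + 1) • g .e x := by
  rw [← Module.End.mul_apply, h.K₁_e, LinearMap.smul_apply, Module.End.mul_apply, hx, map_smul,
    smul_smul, zpow_add_one₀ v_ne_zero, mul_comm]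

theorem K₁_f_apply (h : PCompatible d g) {n : ℤ} {x : M} (hx : g .K₁ x = v ^ n • x) :
    g .K₁ (g .f x) = v ^ (n - 1) • g .f x := by
  rw [← Module.End.mul_apply, h.K₁_f, LinearMap.smul_apply, Module.End.mul_apply, hx, map_smul,
    smul_smul, zpow_sub_one₀ v_ne_zero, mul_comm]

theorem K₁_e_pow_apply (h : PCompatible d g) {n : ℤ} {x : M} (hx : g .K₁ x = v ^ n • x) (r : ℕ) :
    g .K₁ ((g .e ^ r) x) = v ^ (n + r) • (g .e ^ r) x := by
  induction r with
  | zero => simpa using hx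
  | succ r ih =>
    rw [pow_succ', Module.End.mul_apply, h.K₁_e_apply ih]
    push_cast
    rw [add_assoc]

theorem K₁_f_pow_apply (h : PCompatible d g) {n : ℤ} {x : M} (hx : g .K₁ x = v ^ n • x) (r : ℕ) :
    g .K₁ ((g .f ^ r) x) = v ^ (n - r) • (g .f ^ r) x := by
  induction r with
  | zero => simpa using hx
  | succ r ih =>
    rw [pow_succ', Module.End.mul_apply, h.K₁_f_apply ih]
    push_cast
    rw [sub_sub]

theorem prod_apply {M : Type*} [AddCommGroup M] [Module Qv M] {K : Module.End Qv M} {c : Qv}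
    {x : M} (hx : K x = c • x) (l : List ℕ) :
    (l.map fun i => K - algebraMap Qv (Module.End Qv M) (v ^ i)).prod x =
      (l.map fun i => c - v ^ i).prod • x := by
  induction l with
  | nil => simp
  | cons i l ih =>
    rw [List.map_cons, List.prod_cons, Module.End.mul_apply, ih, map_smul, List.map_cons,
      List.prod_cons, LinearMap.sub_apply, hx, Module.algebraMap_end_apply, ← sub_smul, smul_smul,
      mul_comm]

/-- The polynomial relation acts on `x` by the product of the `v ^ n - v ^ i`, so one factor
vanishes. -/
theorem weight_mem_range (h : PCompatible d g) {n : ℤ} {x : M} (hx : g .K₁ x = v ^ n • x)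
    (hx0 : x ≠ 0) : 0 ≤ n ∧ n ≤ d := by
  have h1 := prod_apply hx (List.range (d + 1))
  rw [h.K₁_min, LinearMap.zero_apply] at h1
  have h2 := (smul_eq_zero.1 h1.symm).resolve_right hx0
  rw [List.prod_eq_zero_iff, List.mem_map] at h2
  obtain ⟨i, hi, hi'⟩ := h2
  have := v_zpow_injective (a₁ := n) (a₂ := i) (by simpa using sub_eq_zero.1 hi')
  have := List.mem_range.1 hi
  omega

theorem exists_e_pow (h : PCompatible d g) {n : ℤ} {x : M} (hx : g .K₁ x = v ^ n • x)
    (hx0 : x ≠ 0) : ∃ r : ℕ, (g .e ^ r) x ≠ 0 ∧ g .e ((g .e ^ r) x) = 0 := by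
  classical
  -- As `n ≥ 0`, a nonzero `e ^ (d + 1) x` would have weight above `d`.
  have hex : ∃ r : ℕ, (g .e ^ r) x = 0 := by
    refine ⟨d + 1 , by_contra fun hr => ?_⟩
    have h1 := h.weight_mem_range (h.K₁_e_pow_apply hx _) hr
    have h2 := h.weight_mem_range hx hx0
    push_cast at h1
    omega
  have hmin := fun r => Nat.find_min hex (m := r)
  have hspec := Nat.find_spec hex
  rcases hN : Nat.find hex with _ | r
  · rw [hN] at hspec
    exact absurd hspec (by simpa using hx0)
  · refine ⟨r, hmin _ (by omega), ?_⟩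
    rw [← Module.End.mul_apply, ← pow_succ', ← hN, hspec]

theorem exists_f_pow (h : PCompatible d g) {n : ℤ} {x : M} (hx : g .K₁ x = v ^ n • x)
    (hx0 : x ≠ 0) : ∃ r : ℕ, (g .f ^ r) x ≠ 0 ∧ g .f ((g .f ^ r) x) = 0 := by
  classical
  -- As `n ≤ d`, a nonzero `f ^ (d + 1) x` would have negative weight.
  have hex : ∃ r : ℕ, (g .f ^ r) x = 0 := by
    refine ⟨d + 1 , by_contra fun hr => ?_⟩
    have h1 := h.weight_mem_range (h.K₁_f_pow_apply hx _) hr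
    have h2 := h.weight_mem_range hx hx0
    push_cast at h1
    omega
  have hmin := fun r => Nat.find_min hex (m := r)
  have hspec := Nat.find_spec hex
  rcases hN : Nat.find hex with _ | r
  · rw [hN] at hspec
    exact absurd hspec (by simpa using hx0)
  · refine ⟨r, hmin _ (by omega), ?_⟩
    rw [← Module.End.mul_apply, ← pow_succ', ← hN, hspec]

theorem casimir_apply_of_e (h : PCompatible d g) {n : ℤ} {x : M} (hx : g .K₁ x = v ^ n • x)
    (he : g .e x = 0) : casimir d g x = casimirScalar d n • x := by
  have hv := v_ne_zero
  have hx' := h.K₁'_apply hx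
  rw [casimir, casimirScalar]
  simp only [LinearMap.add_apply, LinearMap.smul_apply, Module.End.mul_apply, he, pow_two, hx, hx',
    map_smul, map_zero, smul_zero, zero_add, smul_smul, ← add_smul]
  congr 1
  rw [show 2 * n - d + 1 = n + n + -(d : ℤ) + 1 by ring,
    show -(n + n + -(d : ℤ) + 1) = -n + -n + d + -1 by ring]
  simp only [zpow_add₀ hv, zpow_neg, zpow_natCast, zpow_one]
  ring

theorem casimir_apply_of_e_f (h : PCompatible d g) {n : ℤ} {x : M} (hx : g .K₁ x = v ^ n • x)
    (he : g .e (g .f x) = 0) : casimir d g x = casimirScalar d (n - 1) • x := by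
  have hv := v_ne_zero
  have hx' := h.K₁'_apply hx
  rw [h.casimir_eq, casimirScalar]
  simp only [LinearMap.add_apply, LinearMap.smul_apply, Module.End.mul_apply, he, pow_two, hx, hx',
    map_smul, smul_zero, zero_add, smul_smul, ← add_smul]
  congr 1
  rw [show 2 * (n - 1) - d + 1 = n + n + -(d : ℤ) + -1 by ring,
    show -(n + n + -(d : ℤ) + -1) = -n + -n + d + 1 by ring]
  simp only [zpow_add₀ hv, zpow_neg, zpow_natCast, zpow_one]
  ring

theorem casimirScalar_inj {n m : ℤ} {T : Module.End Qv M} {x : M} (hx0 : x ≠ 0)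
    (h1 : T x = casimirScalar d n • x) (h2 : T x = casimirScalar d m • x) :
    n = m ∨ n + m = d - 1 :=
  casimirScalar_eq (smul_left_injective Qv hx0 (h1.symm.trans h2))

/-- Highest weights are dominant. -/
theorem le_of_highest (h : PCompatible d g) {n : ℤ} {x : M} (hx : g .K₁ x = v ^ n • x)
    (hx0 : x ≠ 0) (he : g .e x = 0) : (d : ℤ) ≤ 2 * n := by
  obtain ⟨r, hr0, hr⟩ := h.exists_f_pow hx hx0
  have h1 : casimir d g ((g .f ^ r) x) = casimirScalar d n • (g .f ^ r) x := by
    rw [← Module.End.mul_apply, (h.commute_casimir_f.pow_right r).eq, Module.End.mul_apply,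
      h.casimir_apply_of_e hx he, map_smul]
  have h2 := h.casimir_apply_of_e_f (h.K₁_f_pow_apply hx r) (by rw [hr, map_zero])
  have := casimirScalar_inj hr0 h1 h2
  omega

/-- Above the middle weight, `e * f` is injective. -/
theorem eq_zero_of_e_f (h : PCompatible d g) {n : ℤ} {x : M} (hx : g .K₁ x = v ^ n • x)
    (hn : (d : ℤ) < 2 * n) (hef : g .e (g .f x) = 0) : x = 0 := by
  by_contra hx0
  -- At the top of the string the scalars of `n - 1` and `n + r` agree, which would force `2n + r =
  -- d`.
  obtain ⟨r, hr0, hr⟩ := h.exists_e_pow hx hx0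
  have h1 : casimir d g ((g .e ^ r) x) = casimirScalar d (n - 1) • (g .e ^ r) x := by
    rw [← Module.End.mul_apply, (h.commute_casimir_e.pow_right r).eq, Module.End.mul_apply,
      h.casimir_apply_of_e_f hx hef, map_smul]
  have h2 := h.casimir_apply_of_e (h.K₁_e_pow_apply hx r) hr
  have := casimirScalar_inj hr0 h1 h2
  omega

/-- Multiplying in the factors one at a time, the last nonzero partial product applied to `x` is an
eigenvector, and it stays in the stable subspace `N`. -/
theorem exists_eigenvector {M : Type*} [AddCommGroup M] [Module Qv M] {K : Module.End Qv M}
    {N : Submodule Qv M} (hK : ∀ x ∈ N, K x ∈ N) (l : List ℕ) {x : M} (hxN : x ∈ N) (hx0 : x ≠ 0)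
    (hl : (l.map fun i => K - algebraMap Qv (Module.End Qv M) (v ^ i)).prod x = 0) :
    ∃ n : ℤ, ∃ y ∈ N, y ≠ 0 ∧ K y = v ^ n • y := by
  have hmem : ∀ l : List ℕ,
      (l.map fun i => K - algebraMap Qv (Module.End Qv M) (v ^ i)).prod x ∈ N := by
    intro l
    induction l with
    | nil => simpa using hxN
    | cons i l ih =>
      rw [List.map_cons, List.prod_cons, Module.End.mul_apply, LinearMap.sub_apply,
        Module.algebraMap_end_apply]
      exact N.sub_mem (hK _ ih) (N.smul_mem _ ih)
  induction l with
  | nil => exact absurd (by simpa using hl) hx0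
  | cons i l ih =>
    by_cases h0 : (l.map fun i => K - algebraMap Qv (Module.End Qv M) (v ^ i)).prod x = 0
    · exact ih h0
    · refine ⟨i, _, hmem l, h0, ?_⟩
      rw [List.map_cons, List.prod_cons, Module.End.mul_apply, LinearMap.sub_apply,
        Module.algebraMap_end_apply, sub_eq_zero] at hl
      rw [hl, zpow_natCast]

theorem exists_highest (h : PCompatible d g) {N : Submodule Qv M}
    (hK : ∀ x ∈ N, g .K₁ x ∈ N) (he : ∀ x ∈ N, g .e x ∈ N) (hN : N ≠ ⊥) :
    ∃ n : ℤ, ∃ y ∈ N, y ≠ 0 ∧ g .K₁ y = v ^ n • y ∧ g .e y = 0 := by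
  obtain ⟨x, hxN, hx0⟩ := N.ne_bot_iff.1 hN
  obtain ⟨n, y, hyN, hy0, hy⟩ := exists_eigenvector hK (List.range (d + 1)) hxN hx0
    (by rw [h.K₁_min, LinearMap.zero_apply])
  obtain ⟨r, hr0, hr⟩ := h.exists_e_pow hy hy0
  refine ⟨n + r, _, ?_, hr0, h.K₁_e_pow_apply hy r, hr⟩
  clear hr0 hr
  induction r with
  | zero => simpa using hyN
  | succ r ih => rw [pow_succ', Module.End.mul_apply]; exact he _ ih

end Module

end PCompatible

/-! ### Weights and highest weight vectors of the tensor powers -/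

/-- The canonical generator `x ⊗ y` of `E^{⊗ (d + 1)}`. -/
def tensorCons (d : ℕ) (x : ⨂[Qv]^d E) (y : E) : ⨂[Qv]^(d + 1) E := tensorPowSucc d (x ⊗ₜ y)

theorem ρpow_succ_apply (d : ℕ) (u : U) (z : (⨂[Qv]^d E) ⊗[Qv] E) :
    ρpow (d + 1) u (tensorPowSucc d z) = tensorPowSucc d
      (Module.endTensorEndAlgHom (R := Qv) (A := Qv) (S := Qv) (M := ⨂[Qv]^d E) (N := E)
        (Algebra.TensorProduct.map (ρpow d) ρ (U.Δ u)) z) := by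
  change tensorPowSucc d
    (Module.endTensorEndAlgHom (R := Qv) (A := Qv) (S := Qv) (M := ⨂[Qv]^d E) (N := E)
      (Algebra.TensorProduct.map (ρpow d) ρ (U.Δ u))
        ((tensorPowSucc d).symm (tensorPowSucc d z))) = _
  rw [LinearEquiv.symm_apply_apply]

theorem ρpow_zero_gen (x : UGen) : ρpow 0 (U.gen x) = algebraMap Qv _ (U.counitGen x) := by
  change algebraMap Qv _ (U.ε (U.gen x)) = _
  rw [U.ε, U.lift_gen]

theorem ρpow_succ_e (d : ℕ) (x : ⨂[Qv]^d E) (y : E) :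
    ρpow (d + 1) U.e (tensorCons d x y) = tensorCons d (ρpow d U.e x) y +
      tensorCons d (ρpow d U.K₁ (ρpow d U.K₂' x)) (ρ U.e y) := by
  rw [tensorCons, ρpow_succ_apply, U.Δ, U.lift_gen, U.comulGen]
  simp [tensorCons, Module.endTensorEndAlgHom_apply]

theorem ρpow_succ_K₁ (d : ℕ) (x : ⨂[Qv]^d E) (y : E) :
    ρpow (d + 1) U.K₁ (tensorCons d x y) = tensorCons d (ρpow d U.K₁ x) (ρ U.K₁ y) := by
  rw [tensorCons, ρpow_succ_apply, U.Δ, U.lift_gen, U.comulGen]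
  simp [tensorCons, Module.endTensorEndAlgHom_apply]

theorem ρpow_succ_K₂ (d : ℕ) (x : ⨂[Qv]^d E) (y : E) :
    ρpow (d + 1) U.K₂ (tensorCons d x y) = tensorCons d (ρpow d U.K₂ x) (ρ U.K₂ y) := by
  rw [tensorCons, ρpow_succ_apply, U.Δ, U.lift_gen, U.comulGen]
  simp [tensorCons, Module.endTensorEndAlgHom_apply]

theorem ρ_gen (x : UGen) (y : E) : ρ (U.gen x) y = (natGen x).mulVec y := by
  change Matrix.toLin' (U.lift natGen natGen_compatible (U.gen x)) y = _
  rw [U.lift_gen, Matrix.toLin'_apply]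

/-- The first basis vector of `E`. -/
abbrev b₁ : E := ![1, 0]
/-- The second basis vector of `E`. -/
abbrev b₂ : E := ![0, 1]

theorem ρ_e_b₁ : ρ U.e b₁ = 0 := by
  rw [ρ_gen]; ext i; fin_cases i <;> simp [natGen]
theorem ρ_e_b₂ : ρ U.e b₂ = b₁ := by
  rw [ρ_gen]; ext i; fin_cases i <;> simp [natGen]
theorem ρ_K₁_b₁ : ρ U.K₁ b₁ = v • b₁ := by
  rw [ρ_gen]; ext i; fin_cases i <;> simp [natGen]
theorem ρ_K₁_b₂ : ρ U.K₁ b₂ = b₂ := by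
  rw [ρ_gen]; ext i; fin_cases i <;> simp [natGen]
theorem ρ_K₂_b₁ : ρ U.K₂ b₁ = b₁ := by
  rw [ρ_gen]; ext i; fin_cases i <;> simp [natGen]
theorem ρ_K₂_b₂ : ρ U.K₂ b₂ = v • b₂ := by
  rw [ρ_gen]; ext i; fin_cases i <;> simp [natGen]

theorem eq_smul_b₁_add (y : E) : y = y 0 • b₁ + y 1 • b₂ := by
  ext i; fin_cases i <;> simp

theorem tensorCons_smul_left (d : ℕ) (c : Qv) (x : ⨂[Qv]^d E) (y : E) :
    tensorCons d (c • x) y = c • tensorCons d x y := by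
  rw [tensorCons, tensorCons, ← map_smul, TensorProduct.smul_tmul']

theorem tensorCons_smul_right (d : ℕ) (c : Qv) (x : ⨂[Qv]^d E) (y : E) :
    tensorCons d x (c • y) = c • tensorCons d x y := by
  rw [tensorCons, tensorCons, ← map_smul, TensorProduct.tmul_smul]

theorem tensorCons_zero_left (d : ℕ) (y : E) : tensorCons d 0 y = 0 := by
  rw [tensorCons, TensorProduct.zero_tmul, map_zero]

theorem tensorCons_zero_right (d : ℕ) (x : ⨂[Qv]^d E) : tensorCons d x 0 = 0 := by
  rw [tensorCons, TensorProduct.tmul_zero, map_zero]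

/-- Vectors `x ⊗ b₁ + y ⊗ b₂` vanish only if `x` and `y` do. -/
theorem tensorCons_basis_eq_zero {d : ℕ} {x y : ⨂[Qv]^d E}
    (h : tensorCons d x b₁ + tensorCons d y b₂ = 0) : x = 0 ∧ y = 0 := by
  rw [tensorCons, tensorCons, ← map_add, LinearEquiv.map_eq_zero_iff] at h
  -- Apply the `i`-th coordinate functional to the last tensor factor.
  have key : ∀ i : Fin 2, b₁ i • x + b₂ i • y = 0 := by
    intro i
    have := congrArg (fun z => TensorProduct.rid Qv _
      (LinearMap.lTensor (⨂[Qv]^d E) (LinearMap.proj i : E →ₗ[Qv] Qv) z)) h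
    simpa using this
  exact ⟨by simpa using key 0, by simpa using key 1⟩

/-- The vectors of weight `(i, d - i)` in `E^{⊗ d}`, for all `i`. -/
def weightVectors (d : ℕ) : Set (⨂[Qv]^d E) :=
  {x | ∃ i j : ℕ, i + j = d ∧ ρpow d U.K₁ x = v ^ i • x ∧ ρpow d U.K₂ x = v ^ j • x}

theorem tensorCons_mem_weightVectors {d : ℕ} {x : ⨂[Qv]^d E} (hx : x ∈ weightVectors d) :
    tensorCons d x b₁ ∈ weightVectors (d + 1) ∧ tensorCons d x b₂ ∈ weightVectors (d + 1) := by
  obtain ⟨i, j, hij, h1, h2⟩ := hx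
  refine ⟨⟨i + 1, j, by omega, ?_, ?_⟩, ⟨i, j + 1, by omega, ?_, ?_⟩⟩ <;>
    simp only [ρpow_succ_K₁, ρpow_succ_K₂, h1, h2, ρ_K₁_b₁, ρ_K₁_b₂, ρ_K₂_b₁, ρ_K₂_b₂,
      tensorCons_smul_left, tensorCons_smul_right, smul_smul, pow_succ, mul_comm]

/-- Reduces operator identities in `K₁` and `K₂` to a check on weight vectors. -/
theorem span_weightVectors (d : ℕ) : Submodule.span Qv (weightVectors d) = ⊤ := by
  induction d with
  | zero =>
    refine Submodule.eq_top_iff'.2 fun x => Submodule.subset_span ⟨0, 0, rfl, ?_, ?_⟩ <;>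
      simp [ρpow_zero_gen, U.counitGen]
  | succ d ih =>
    refine Submodule.eq_top_iff'.2 fun z => ?_
    obtain ⟨z, rfl⟩ := (tensorPowSucc d).surjective z
    induction z with
    | zero => rw [map_zero]; exact Submodule.zero_mem _
    | add a b ha hb => rw [map_add]; exact Submodule.add_mem _ ha hb
    | tmul x y =>
      have hx : x ∈ Submodule.span Qv (weightVectors d) := ih ▸ Submodule.mem_top
      induction hx using Submodule.span_induction with
      | mem x hx =>
        obtain ⟨h1, h2⟩ := tensorCons_mem_weightVectors hx
        rw [eq_smul_b₁_add y, TensorProduct.tmul_add, map_add, TensorProduct.tmul_smul,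
          TensorProduct.tmul_smul, map_smul, map_smul]
        exact Submodule.add_mem _ (Submodule.smul_mem _ _ (Submodule.subset_span h1))
          (Submodule.smul_mem _ _ (Submodule.subset_span h2))
      | zero => rw [TensorProduct.zero_tmul, map_zero]; exact Submodule.zero_mem _
      | add a b _ _ ha hb => rw [TensorProduct.add_tmul, map_add]; exact Submodule.add_mem _ ha hb
      | smul c a _ ha =>
        rw [← TensorProduct.smul_tmul', map_smul]; exact Submodule.smul_mem _ _ ha

theorem ρpow_K₂ (d : ℕ) : ρpow d U.K₂ = v ^ d • ρpow d U.K₁' := by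
  have h : ρpow d U.K₁ * ρpow d U.K₂ = algebraMap Qv _ (v ^ d) := by
    refine LinearMap.ext_on (span_weightVectors d) ?_
    rintro x ⟨i, j, hij, h1, h2⟩
    rw [Module.End.mul_apply, h2, map_smul, h1, smul_smul, Module.algebraMap_end_apply,
      ← pow_add, add_comm, hij]
  have h' := congrArg (ρpow d U.K₁' * ·) h
  simp only [← mul_assoc, ← map_mul, U.inv_mul_K₁, one_mul] at h'
  rw [h', Algebra.smul_def, Algebra.commutes]

theorem ρpow_K₂' (d : ℕ) : ρpow d U.K₂' = (v ^ d)⁻¹ • ρpow d U.K₁ := by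
  have h1 : ρpow d U.K₁' * ρpow d U.K₂' = algebraMap Qv _ ((v ^ d)⁻¹) := by
    have h2 : ρpow d U.K₂ * ρpow d U.K₂' = 1 := by rw [← map_mul, U.K₂_mul_inv, map_one]
    rw [ρpow_K₂, smul_mul_assoc] at h2
    rw [← eq_inv_smul_iff₀ (pow_ne_zero d v_ne_zero)] at h2
    rw [h2, Algebra.algebraMap_eq_smul_one]
  have h' := congrArg (ρpow d U.K₁ * ·) h1
  simp only [← mul_assoc, ← map_mul, U.K₁_mul_inv, one_mul] at h'
  rw [h', Algebra.smul_def, Algebra.commutes]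

/-- The images of the generators of the presentation in `End(E^{⊗ d})`. -/
def powGen (d : ℕ) : PGen → Module.End Qv (⨂[Qv]^d E)
  | .e => ρpow d U.e
  | .f => ρpow d U.f
  | .K₁ => ρpow d U.K₁
  | .K₁' => ρpow d U.K₁'

theorem powGen_compatible (d : ℕ) : PCompatible d (powGen d) where
  K₁_inv := by simp only [powGen, ← map_mul, U.K₁_mul_inv, map_one]
  inv_K₁ := by simp only [powGen, ← map_mul, U.inv_mul_K₁, map_one]
  K₁_conj_e := by simp only [powGen, ← map_mul, U.K₁_conj_e, map_smul]
  K₁_conj_f := by simp only [powGen, ← map_mul, U.K₁_conj_f, map_smul]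
  e_f := by
    simp only [powGen]
    have h := congrArg (ρpow d) U.e_f_comm
    simp only [map_sub, map_mul, map_smul] at h
    rw [h, ρpow_K₂, ρpow_K₂', mul_smul_comm, mul_smul_comm, pow_two, pow_two]
  K₁_min := by
    refine LinearMap.ext_on (span_weightVectors d) ?_
    rintro x ⟨i, j, hij, h1, -⟩
    rw [powGen, PCompatible.prod_apply h1, LinearMap.zero_apply]
    refine (smul_eq_zero.2 (.inl ?_))
    rw [List.prod_eq_zero_iff, List.mem_map]
    exact ⟨i, List.mem_range.2 (by omega), sub_self _⟩

/-- Every dominant weight is the weight of a highest weight vector of `E^{⊗ d}`. -/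
theorem exists_highest_vector (d i j : ℕ) (hd : i + j = d) (hij : j ≤ i) :
    ∃ w : ⨂[Qv]^d E, w ≠ 0 ∧ ρpow d U.K₁ w = v ^ i • w ∧ ρpow d U.e w = 0 := by
  induction d generalizing i j with
  | zero =>
    obtain rfl : i = 0 := by omega
    refine ⟨PiTensorProduct.isEmptyEquiv (Fin 0) |>.symm (1 : Qv), ?_, ?_, ?_⟩
    · exact (LinearEquiv.map_ne_zero_iff _).2 one_ne_zero
    · simp [ρpow_zero_gen, U.counitGen]
    · simp [ρpow_zero_gen, U.counitGen]
  | succ d ih =>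
    rcases Nat.eq_zero_or_pos j with rfl | hj
    · obtain ⟨k, rfl⟩ : ∃ k, i = k + 1 := ⟨d, by omega⟩
      obtain ⟨w, hw0, hw, he⟩ := ih k 0 (by omega) (by omega)
      refine ⟨tensorCons d w b₁, fun h => hw0 ?_, ?_, ?_⟩
      · exact (tensorCons_basis_eq_zero (y := 0)
          (by rw [h, tensorCons_zero_left, add_zero])).1
      · rw [ρpow_succ_K₁, hw, ρ_K₁_b₁, tensorCons_smul_left, tensorCons_smul_right, smul_smul,
          pow_succ]
      · rw [ρpow_succ_e, he, ρ_e_b₁, tensorCons_zero_left, tensorCons_zero_right, add_zero]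
    · obtain ⟨k, rfl⟩ : ∃ k, j = k + 1 := ⟨j - 1, by omega⟩
      obtain ⟨w, hw0, hw, he⟩ := ih i k (by omega) (by omega)
      have hP := powGen_compatible d
      have hwz : powGen d .K₁ w = v ^ (i : ℤ) • w := by rw [zpow_natCast]; exact hw
      have hw' := hP.K₁'_apply hwz
      have hf := hP.K₁_f_apply hwz
      -- The eigenvalue of `K₁ K₂⁻¹` on `w`, which enters through the comultiplication of `e`.
      obtain ⟨a, ha⟩ : ∃ a : Qv, ρpow d U.K₁ (ρpow d U.K₂' w) = a • w := by
        refine ⟨(v ^ d)⁻¹ * v ^ i * v ^ i, ?_⟩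
        rw [ρpow_K₂', LinearMap.smul_apply, map_smul, hw, map_smul, hw, smul_smul, smul_smul]
      -- Since `e w = 0`, `e f w` is a multiple of `w`. The multiple is nonzero because `d = i + k <
      -- 2i` makes `e f` injective on this weight.
      obtain ⟨c, hc0, hc⟩ : ∃ c : Qv, c ≠ 0 ∧ ρpow d U.e (ρpow d U.f w) = c • w := by
        have hef := congrArg (· w) hP.e_mul_f
        simp only [LinearMap.add_apply, LinearMap.sub_apply, LinearMap.smul_apply,
          Module.End.mul_apply, pow_two, hwz, hw', map_smul] at hef
        have he' : powGen d .e w = 0 := he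
        rw [he', map_zero, zero_add, smul_smul, smul_smul, smul_smul, smul_smul, ← sub_smul,
          smul_smul] at hef
        refine ⟨_, fun hc => hw0 (hP.eq_zero_of_e_f hwz (by omega) ?_), hef⟩
        rw [hef, hc, zero_smul]
      -- Under `e` the first summand goes to `-a c • w ⊗ b₁` and the second to `c a • w ⊗ b₁`.
      refine ⟨tensorCons d (-a • ρpow d U.f w) b₁ + tensorCons d (c • w) b₂, fun h => ?_, ?_, ?_⟩
      · exact hw0 ((smul_eq_zero.1 (tensorCons_basis_eq_zero h).2).resolve_left hc0)
      · have hf' : ρpow d U.K₁ (ρpow d U.f w) = v ^ ((i : ℤ) - 1) • ρpow d U.f w := hf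
        simp only [map_add, ρpow_succ_K₁, map_smul, hf', hw, ρ_K₁_b₁, ρ_K₁_b₂,
          tensorCons_smul_left, tensorCons_smul_right, smul_add, smul_smul]
        congr 2
        · rw [zpow_sub_one₀ v_ne_zero, zpow_natCast]
          field_simp [v_ne_zero]
        · ring
      · simp only [map_add, ρpow_succ_e, map_smul, he, hc, ρ_e_b₁, ρ_e_b₂, ha,
          tensorCons_smul_left, tensorCons_zero_left, tensorCons_zero_right, smul_smul,
          add_zero, zero_add, ← add_smul]
        rw [neg_mul, mul_comm a c, neg_add_cancel, zero_smul]

/-! ### The presented algebra -/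

theorem PCompatible.map {d : ℕ} {A B : Type*} [Ring A] [Algebra Qv A] [Ring B] [Algebra Qv B]
    {g : PGen → A} (h : PCompatible d g) (φ : A →ₐ[Qv] B) : PCompatible d fun x => φ (g x) where
  K₁_inv := by rw [← map_mul, h.K₁_inv, map_one]
  inv_K₁ := by rw [← map_mul, h.inv_K₁, map_one]
  K₁_conj_e := by rw [← map_mul, ← map_mul, h.K₁_conj_e, map_smul]
  K₁_conj_f := by rw [← map_mul, ← map_mul, h.K₁_conj_f, map_smul]
  e_f := by simpa only [map_sub, map_mul, map_smul, map_pow] using congrArg φ h.e_f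
  K₁_min := by
    have := congrArg φ h.K₁_min
    rw [map_list_prod, List.map_map, map_zero] at this
    rw [← this]
    congr 2
    funext i
    rw [Function.comp_apply, map_sub, AlgHom.commutes]

theorem U.adjoin_range_gen : Algebra.adjoin Qv (Set.range U.gen) = ⊤ := by
  have h : Set.range U.gen =
      RingQuot.mkAlgHom Qv URel '' Set.range (FreeAlgebra.ι Qv (X := UGen)) := by
    rw [← Set.range_comp]; rfl
  rw [h, ← AlgHom.map_adjoin, FreeAlgebra.adjoin_range_ι, Algebra.map_top,
    (AlgHom.range_eq_top _).2 (RingQuot.mkAlgHom_surjective Qv URel)]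

namespace Presented

variable {d : ℕ}

theorem gen_compatible (d : ℕ) : PCompatible d (gen d) where
  K₁_inv := by simpa [gen] using RingQuot.mkAlgHom_rel Qv (PRel.K₁_inv (d := d))
  inv_K₁ := by simpa [gen] using RingQuot.mkAlgHom_rel Qv (PRel.inv_K₁ (d := d))
  K₁_conj_e := by simpa [gen] using RingQuot.mkAlgHom_rel Qv (PRel.K₁_e (d := d))
  K₁_conj_f := by simpa [gen] using RingQuot.mkAlgHom_rel Qv (PRel.K₁_f (d := d))
  e_f := by simpa [gen] using RingQuot.mkAlgHom_rel Qv (PRel.e_f (d := d))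
  K₁_min := by
    have h := RingQuot.mkAlgHom_rel Qv (PRel.K₁_min (d := d))
    rw [map_list_prod, List.map_map, map_zero] at h
    rw [← h]
    congr 2
    funext i
    simp [gen]

/-- The algebra homomorphism out of the presented algebra with prescribed values on the
generators. -/
def lift {A : Type*} [Ring A] [Algebra Qv A] (g : PGen → A) (h : PCompatible d g) :
    Presented d →ₐ[Qv] A :=
  RingQuot.liftAlgHom Qv ⟨FreeAlgebra.lift Qv g, by
    intro x y hxy
    cases hxy
    · simpa using h.K₁_inv
    · simpa using h.inv_K₁
    · simpa using h.K₁_conj_e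
    · simpa using h.K₁_conj_f
    · simpa using h.e_f
    · rw [map_list_prod, List.map_map, map_zero, ← h.K₁_min]
      congr 2
      funext i
      simp⟩

@[simp] theorem lift_gen {A : Type*} [Ring A] [Algebra Qv A] (g : PGen → A)
    (h : PCompatible d g) (x : PGen) : lift g h (gen d x) = g x := by
  simp [lift, gen]

theorem adjoin_range_gen (d : ℕ) : Algebra.adjoin Qv (Set.range (gen d)) = ⊤ := by
  have h : Set.range (gen d) =
      RingQuot.mkAlgHom Qv (PRel d) '' Set.range (FreeAlgebra.ι Qv (X := PGen)) := by
    rw [← Set.range_comp]; rfl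
  rw [h, ← AlgHom.map_adjoin, FreeAlgebra.adjoin_range_ι, Algebra.map_top,
    (AlgHom.range_eq_top _).2 (RingQuot.mkAlgHom_surjective Qv (PRel d))]

/-- A right-stable subspace containing `1` is everything. -/
theorem eq_top_of_mul_gen {T : Submodule Qv (Presented d)} (h1 : (1 : Presented d) ∈ T)
    (hT : ∀ x ∈ T, ∀ y, x * gen d y ∈ T) : T = ⊤ := by
  refine Submodule.eq_top_iff'.2 fun z => ?_
  have key : ∀ z ∈ Algebra.adjoin Qv (Set.range (gen d)), ∀ x ∈ T, x * z ∈ T := by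
    intro z hz
    induction hz using Algebra.adjoin_induction with
    | mem z hz => obtain ⟨y, rfl⟩ := hz; exact fun x hx => hT x hx y
    | algebraMap c =>
      intro x hx
      rw [← Algebra.commutes, ← Algebra.smul_def]
      exact T.smul_mem c hx
    | add a b _ _ ha hb => intro x hx; rw [mul_add]; exact T.add_mem (ha x hx) (hb x hx)
    | mul a b _ _ ha hb => intro x hx; rw [← mul_assoc]; exact hb _ (ha x hx)
  simpa using key z (by rw [adjoin_range_gen]; trivial) 1 h1

theorem commute_casimir (z : Presented d) : Commute (casimir d (gen d)) z := by
  have hz : z ∈ Algebra.adjoin Qv (Set.range (gen d)) := by rw [adjoin_range_gen]; trivial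
  induction hz using Algebra.adjoin_induction with
  | mem z hz => obtain ⟨y, rfl⟩ := hz; exact (gen_compatible d).commute_casimir_gen y
  | algebraMap c => exact (Algebra.commutes c _).symm
  | add a b _ _ ha hb => exact ha.add_right hb
  | mul a b _ _ ha hb => exact ha.mul_right hb

/-- Left multiplication by the generators. -/
def leftGen (d : ℕ) (x : PGen) : Module.End Qv (Presented d) := LinearMap.mulLeft Qv (gen d x)

/-- Right multiplication by the generators, with `e` and `f` interchanged. -/
def rightGen (d : ℕ) : PGen → Module.End Qv (Presented d)
  | .e => LinearMap.mulRight Qv (gen d .f)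
  | .f => LinearMap.mulRight Qv (gen d .e)
  | .K₁ => LinearMap.mulRight Qv (gen d .K₁)
  | .K₁' => LinearMap.mulRight Qv (gen d .K₁')

theorem leftGen_compatible (d : ℕ) : PCompatible d (leftGen d) :=
  (gen_compatible d).map (B := Module.End Qv (Presented d)) (Algebra.lmul Qv (Presented d))

/-- Right multiplication reverses products, which is harmless as the factors commute. -/
theorem prod_mulRight_apply {A : Type*} [Ring A] [Algebra Qv A] (K x : A) (l : List ℕ) :
    (l.map fun i => LinearMap.mulRight Qv K - algebraMap Qv (Module.End Qv A) (v ^ i)).prod x =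
      x * (l.map fun i => K - algebraMap Qv A (v ^ i)).prod := by
  induction l with
  | nil => simp
  | cons i l ih =>
    have hc : Commute (K - algebraMap Qv A (v ^ i))
        (l.map fun i => K - algebraMap Qv A (v ^ i)).prod := by
      refine Commute.list_prod_right _ _ fun y hy => ?_
      obtain ⟨j, -, rfl⟩ := List.mem_map.1 hy
      exact ((Commute.refl K).sub_right (Algebra.commutes _ _).symm).sub_left
        (Algebra.commutes _ _)
    rw [List.map_cons, List.prod_cons, Module.End.mul_apply, ih, List.map_cons, List.prod_cons,
      hc.eq, LinearMap.sub_apply, LinearMap.mulRight_apply, Module.algebraMap_end_apply,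
      ← mul_assoc, mul_sub, ← Algebra.commutes, ← Algebra.smul_def]

/-- Reversing products while exchanging `e` and `f` preserves the relations, so all module results
also apply to right multiplication. -/
theorem rightGen_compatible (d : ℕ) : PCompatible d (rightGen d) := by
  have h := gen_compatible d
  have he : gen d .K₁' * (gen d .e * gen d .K₁) = v⁻¹ • gen d .e := by
    rw [← mul_assoc, h.K₁'_e, smul_mul_assoc, mul_assoc, h.inv_K₁, mul_one]
  have hf : gen d .K₁' * (gen d .f * gen d .K₁) = v • gen d .f := by
    rw [← mul_assoc, h.K₁'_f, smul_mul_assoc, mul_assoc, h.inv_K₁, mul_one]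
  constructor
  · refine LinearMap.ext fun x => ?_
    simp only [rightGen, Module.End.mul_apply, LinearMap.mulRight_apply, Module.End.one_apply,
      mul_assoc, h.inv_K₁, mul_one]
  · refine LinearMap.ext fun x => ?_
    simp only [rightGen, Module.End.mul_apply, LinearMap.mulRight_apply, Module.End.one_apply,
      mul_assoc, h.K₁_inv, mul_one]
  · refine LinearMap.ext fun x => ?_
    simp only [rightGen, Module.End.mul_apply, LinearMap.mulRight_apply, LinearMap.smul_apply,
      mul_assoc, hf, mul_smul_comm]
  · refine LinearMap.ext fun x => ?_
    simp only [rightGen, Module.End.mul_apply, LinearMap.mulRight_apply, LinearMap.smul_apply,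
      mul_assoc, he, mul_smul_comm]
  · refine LinearMap.ext fun x => ?_
    simp only [rightGen, pow_two, Module.End.mul_apply, LinearMap.mulRight_apply,
      LinearMap.smul_apply, LinearMap.sub_apply, mul_assoc]
    rw [← mul_sub, h.e_f, mul_smul_comm, mul_sub, mul_smul_comm, mul_smul_comm, pow_two, pow_two]
  · refine LinearMap.ext fun x => ?_
    rw [rightGen, prod_mulRight_apply, h.K₁_min, mul_zero, LinearMap.zero_apply]

/-- The system of weight projectors of the presented algebra. -/
structure IsProjectors (d : ℕ) (p : ℕ → Presented d) : Prop where
  K₁_mul : ∀ i, gen d .K₁ * p i = v ^ i • p i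
  mul_K₁ : ∀ i, p i * gen d .K₁ = v ^ i • p i
  sum_eq_one : ∑ i ∈ Finset.range (d + 1), p i = 1

/-! ### Calculus of the weight idempotents. -/

namespace IsProjectors

variable {p : ℕ → Presented d}

theorem mul_eq_zero (hp : IsProjectors d p) {i : ℕ} {n : ℤ} {x : Presented d}
    (hx : gen d .K₁ * x = v ^ n • x) (hi : (i : ℤ) ≠ n) : p i * x = 0 := by
  have h : v ^ (i : ℤ) • (p i * x) = v ^ n • (p i * x) := by
    rw [zpow_natCast, ← smul_mul_assoc, ← hp.mul_K₁, mul_assoc, hx, mul_smul_comm]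
  by_contra h0
  exact hi (v_zpow_injective (smul_left_injective Qv h0 h))

theorem mul_eq_zero' (hp : IsProjectors d p) {i : ℕ} {n : ℤ} {x : Presented d}
    (hx : x * gen d .K₁ = v ^ n • x) (hi : (i : ℤ) ≠ n) : x * p i = 0 := by
  have h : v ^ (i : ℤ) • (x * p i) = v ^ n • (x * p i) := by
    rw [zpow_natCast, ← mul_smul_comm, ← hp.K₁_mul, ← mul_assoc, hx, smul_mul_assoc]
  by_contra h0
  exact hi (v_zpow_injective (smul_left_injective Qv h0 h))

theorem mul_eq_self (hp : IsProjectors d p) {i : ℕ} {x : Presented d}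
    (hx : gen d .K₁ * x = v ^ (i : ℤ) • x) : p i * x = x := by
  rcases le_or_gt i d with hi | hi
  · conv_rhs => rw [← one_mul x, ← hp.sum_eq_one, Finset.sum_mul]
    refine (Finset.sum_eq_single_of_mem (f := fun j => p j * x) i
      (Finset.mem_range.2 (Nat.lt_succ_of_le hi)) fun j _ hj => ?_).symm
    exact hp.mul_eq_zero hx (by exact_mod_cast hj)
  -- For `i > d` the weight is out of range, so `x = 0`.
  · by_contra h0
    have hx0 : x ≠ 0 := fun h => h0 (by rw [h, mul_zero])
    have := (leftGen_compatible d).weight_mem_range (x := x) hx hx0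
    omega

theorem mul_eq_self' (hp : IsProjectors d p) {i : ℕ} {x : Presented d}
    (hx : x * gen d .K₁ = v ^ (i : ℤ) • x) : x * p i = x := by
  rcases le_or_gt i d with hi | hi
  · conv_rhs => rw [← mul_one x, ← hp.sum_eq_one, Finset.mul_sum]
    refine (Finset.sum_eq_single_of_mem (f := fun j => x * p j) i
      (Finset.mem_range.2 (Nat.lt_succ_of_le hi)) fun j _ hj => ?_).symm
    exact hp.mul_eq_zero' hx (by exact_mod_cast hj)
  · by_contra h0
    have hx0 : x ≠ 0 := fun h => h0 (by rw [h, zero_mul])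
    have := (rightGen_compatible d).weight_mem_range (x := x) hx hx0
    omega

theorem K₁_mul' (hp : IsProjectors d p) (i : ℕ) (x : Presented d) :
    gen d .K₁ * (p i * x) = v ^ (i : ℤ) • (p i * x) := by
  rw [← mul_assoc, hp.K₁_mul, smul_mul_assoc, zpow_natCast]

/-- By the weights on either side, both products equal `p i * f * p (i + 1)`. -/
theorem mul_f (hp : IsProjectors d p) (i : ℕ) : p i * gen d .f = gen d .f * p (i + 1) := by
  have h := gen_compatible d
  have h1 : p i * gen d .f * gen d .K₁ = v ^ ((i + 1 : ℕ) : ℤ) • (p i * gen d .f) := by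
    have : gen d .f * gen d .K₁ = v • (gen d .K₁ * gen d .f) := by
      rw [h.K₁_f, smul_smul, mul_inv_cancel₀ v_ne_zero, one_smul]
    rw [mul_assoc, this, mul_smul_comm, ← mul_assoc, hp.mul_K₁, smul_mul_assoc, smul_smul,
      zpow_natCast, pow_succ']
  have h2 : gen d .K₁ * (gen d .f * p (i + 1)) = v ^ (i : ℤ) • (gen d .f * p (i + 1)) := by
    rw [← mul_assoc, h.K₁_f, smul_mul_assoc, mul_assoc, hp.K₁_mul, mul_smul_comm, smul_smul,
      zpow_natCast, pow_succ', inv_mul_cancel_left₀ v_ne_zero]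
  rw [← hp.mul_eq_self' h1, mul_assoc, hp.mul_eq_self h2]

theorem mul_e_pow (hp : IsProjectors d p) (i j : ℕ) :
    p i * gen d .e ^ j * gen d .K₁ = v ^ ((i : ℤ) - j) • (p i * gen d .e ^ j) := by
  have h := (rightGen_compatible d).K₁_f_pow_apply (n := i) (x := p i)
    (by simpa [rightGen] using hp.mul_K₁ i) j
  simpa only [rightGen, LinearMap.pow_mulRight, LinearMap.mulRight_apply] using h

end IsProjectors

theorem exists_isProjectors (d : ℕ) : ∃ p, IsProjectors d p :=
  let ⟨p, h1, h2, h3⟩ := (gen_compatible d).exists_projectors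
  ⟨p, h1, h2, h3⟩

/-- Modulo the right ideal generated by `f`, the presented algebra is spanned by the elements
`p i * e ^ j`. -/
theorem span_projector_mul_e_pow {p : ℕ → Presented d} (hp : IsProjectors d p) :
    LinearMap.range (LinearMap.mulLeft Qv (gen d .f)) ⊔
      Submodule.span Qv (Set.range fun ij : ℕ × ℕ => p ij.1 * gen d .e ^ ij.2) = ⊤ := by
  have h := gen_compatible d
  set R := LinearMap.range (LinearMap.mulLeft Qv (gen d .f))
  set S := Submodule.span Qv (Set.range fun ij : ℕ × ℕ => p ij.1 * gen d .e ^ ij.2)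
  have hS' : ∀ i j, p i * gen d .e ^ j ∈ R ⊔ S := fun i j =>
    Submodule.mem_sup_right (Submodule.subset_span ⟨(i, j), rfl⟩)
  -- `R` is a right ideal, so stability needs checking only on the spanning elements of `S`.
  have step : ∀ y : PGen, (∀ i j, p i * gen d .e ^ j * gen d y ∈ R ⊔ S) →
      ∀ x ∈ R ⊔ S, x * gen d y ∈ R ⊔ S := by
    intro y hy x hx
    have hle : R ⊔ S ≤ (R ⊔ S).comap (LinearMap.mulRight Qv (gen d y)) := by
      refine sup_le ?_ (Submodule.span_le.2 ?_)
      · rintro _ ⟨z, rfl⟩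
        exact Submodule.mem_sup_left ⟨z * gen d y, by simp [mul_assoc]⟩
      · rintro _ ⟨⟨i, j⟩, rfl⟩
        exact hy i j
    exact hle hx
  have hKstep := step .K₁ fun i j => by rw [hp.mul_e_pow]; exact Submodule.smul_mem _ _ (hS' i j)
  have hK'step := step .K₁' fun i j => by
    have := (rightGen_compatible d).K₁'_apply (hp.mul_e_pow i j)
    change p i * gen d .e ^ j * gen d .K₁' = _ at this
    rw [this]; exact Submodule.smul_mem _ _ (hS' i j)
  have hestep := step .e fun i j => by
    rw [mul_assoc, ← pow_succ]; exact hS' i (j + 1)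
  refine eq_top_of_mul_gen ?_ fun x hx y => ?_
  · rw [← hp.sum_eq_one]
    exact Submodule.sum_mem _ fun i _ => by simpa using hS' i 0
  · cases y
    · exact hestep x hx
    -- Induction on `j` using `e ^ (j + 1) f = e ^ j f e + e ^ j (e f - f e)`; at `j = 0`, `p i * f
    -- = f * p (i + 1)` lies in `R`.
    · refine step .f (fun i j => ?_) x hx
      induction j with
      | zero =>
        refine Submodule.mem_sup_left ⟨p (i + 1), ?_⟩
        simp [hp.mul_f]
      | succ j ih =>
        rw [pow_succ, mul_assoc, mul_assoc, h.e_mul_f, mul_add, mul_add, ← mul_assoc (gen d .e ^ j),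
          ← mul_assoc, ← mul_assoc]
        refine Submodule.add_mem _ (hestep _ ih) ?_
        rw [mul_smul_comm, mul_smul_comm, mul_sub, mul_sub, mul_smul_comm, mul_smul_comm,
          mul_smul_comm, mul_smul_comm, pow_two, pow_two, ← mul_assoc, ← mul_assoc, ← mul_assoc,
          ← mul_assoc]
        refine Submodule.smul_mem _ _ (Submodule.sub_mem _ (Submodule.smul_mem _ _ ?_)
          (Submodule.smul_mem _ _ ?_))
        · exact hKstep _ (hKstep _ (hS' i j))
        · exact hK'step _ (hK'step _ (hS' i j))
    · exact hKstep x hx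
    · exact hK'step x hx

/-- Sandwich the spanning result between two copies of `p i`. The part in `f A` becomes `f * p (i +
1) * u * p i`, and `p i * p k * e ^ j * p i` vanishes for weight reasons unless `k = i` and `j = 0`.
-/
theorem exists_eq_f_mul_add {p : ℕ → Presented d} (hp : IsProjectors d p) {i : ℕ}
    {x : Presented d} (hl : gen d .K₁ * x = v ^ (i : ℤ) • x)
    (hr : x * gen d .K₁ = v ^ (i : ℤ) • x) :
    ∃ (u : Presented d) (a : Qv), gen d .K₁ * u = v ^ ((i : ℤ) + 1) • u ∧
      x = gen d .f * u + a • p i := by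
  have hpi : p i * p i = p i := hp.mul_eq_self (by rw [hp.K₁_mul, zpow_natCast])
  have key : ∀ z : Presented d, ∃ (u : Presented d) (a : Qv),
      p i * z * p i = gen d .f * (p (i + 1) * u) + a • p i := by
    intro z
    have hz : z ∈ LinearMap.range (LinearMap.mulLeft Qv (gen d .f)) ⊔
        Submodule.span Qv (Set.range fun ij : ℕ × ℕ => p ij.1 * gen d .e ^ ij.2) := by
      rw [span_projector_mul_e_pow hp]; trivial
    obtain ⟨_, ⟨u, rfl⟩, y, hy, rfl⟩ := Submodule.mem_sup.1 hz
    clear hz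
    have hy' : ∃ a : Qv, p i * y * p i = a • p i := by
      induction hy using Submodule.span_induction with
      | mem y hy =>
        obtain ⟨⟨k, j⟩, rfl⟩ := hy
        by_cases hk : k = i
        · subst hk
          rcases Nat.eq_zero_or_pos j with rfl | hj
          · exact ⟨1, by simp [hpi]⟩
          · refine ⟨0, ?_⟩
            have := hp.mul_eq_zero' (i := k) (hp.mul_e_pow k j) (by omega)
            rw [mul_assoc, this, mul_zero, zero_smul]
        · refine ⟨0, ?_⟩
          have := hp.mul_eq_zero (i := i) (hp.K₁_mul' k (gen d .e ^ j))
            (by exact_mod_cast Ne.symm hk)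
          rw [this, zero_mul, zero_smul]
      | zero => exact ⟨0, by simp⟩
      | add y z _ _ hy hz =>
        obtain ⟨a, ha⟩ := hy
        obtain ⟨b, hb⟩ := hz
        exact ⟨a + b, by rw [mul_add, add_mul, ha, hb, add_smul]⟩
      | smul c y _ hy =>
        obtain ⟨a, ha⟩ := hy
        exact ⟨c * a, by rw [mul_smul_comm, smul_mul_assoc, ha, smul_smul]⟩
    obtain ⟨a, ha⟩ := hy'
    refine ⟨u * p i, a, ?_⟩
    rw [mul_add, add_mul, ha, LinearMap.mulLeft_apply, ← mul_assoc, hp.mul_f]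
    simp only [mul_assoc]
  obtain ⟨u, a, h⟩ := key x
  refine ⟨p (i + 1) * u, a, ?_, ?_⟩
  · simpa using hp.K₁_mul' (i + 1) u
  · rw [← h, hp.mul_eq_self hl, hp.mul_eq_self' hr]

/-- The action of the presented algebra on the tensor power. -/
def toEnd (d : ℕ) : Presented d →ₐ[Qv] Module.End Qv (⨂[Qv]^d E) :=
  lift (powGen d) (powGen_compatible d)

theorem toEnd_injective (d : ℕ) : Function.Injective (toEnd d) := by
  have hL := leftGen_compatible d
  have hR := rightGen_compatible d
  have hV := powGen_compatible d
  set J : Submodule Qv (Presented d) := LinearMap.ker (toEnd d).toLinearMap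
  have hJ' : ∀ x, x ∈ J ↔ toEnd d x = 0 := fun x => LinearMap.mem_ker
  have hJl : ∀ x ∈ J, ∀ y, y * x ∈ J := fun x hx y => by
    rw [hJ'] at hx ⊢; rw [map_mul, hx, mul_zero]
  have hJr : ∀ x ∈ J, ∀ y, x * y ∈ J := fun x hx y => by
    rw [hJ'] at hx ⊢; rw [map_mul, hx, zero_mul]
  suffices hbot : J = ⊥ from
    (injective_iff_map_eq_zero (toEnd d)).2 fun x hx => by
    simpa [hbot] using (hJ' x).2 hx
  by_contra hne
  obtain ⟨n, y, hyJ, hy0, hyK, hye⟩ :=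
    hL.exists_highest (N := J) (fun x hx => hJl x hx _) (fun x hx => hJl x hx _) hne
  -- the highest weight vectors of weight `n` in `J` form a right ideal
  let N : Submodule Qv (Presented d) := J ⊓ LinearMap.ker (leftGen d .e) ⊓
    LinearMap.ker (leftGen d .K₁ - algebraMap Qv _ (v ^ n))
  have hN : ∀ x, x ∈ N ↔ x ∈ J ∧ gen d .e * x = 0 ∧ gen d .K₁ * x = v ^ n • x := fun x => by
    simp [N, leftGen, sub_eq_zero, and_assoc]
  have hNr : ∀ x ∈ N, ∀ y, x * y ∈ N := fun x hx y => by
    rw [hN] at hx ⊢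
    refine ⟨hJr x hx.1 y, ?_, ?_⟩
    · rw [← mul_assoc, hx.2.1, zero_mul]
    · rw [← mul_assoc, hx.2.2, smul_mul_assoc]
  -- Right multiplication by `f` plays the role of `e`, so `hxf` says `x f = 0`.
  obtain ⟨m, x, hxN, hx0, hxK, hxf⟩ := hR.exists_highest (N := N)
    (fun x hx => hNr x hx _) (fun x hx => hNr x hx _)
    (N.ne_bot_iff.2 ⟨y, (hN y).2 ⟨hyJ, hye, hyK⟩, hy0⟩)
  obtain ⟨hxJ, hxe, hxK'⟩ := (hN x).1 hxN
  have hn := hL.le_of_highest (x := x) hxK' hx0 hxe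
  have hm := hR.le_of_highest hxK hx0 hxf
  have hCl : casimir d (gen d) * x = casimirScalar d n • x := by
    rw [← hL.casimir_apply_of_e (x := x) hxK' hxe]
    simp [casimir, leftGen, pow_two, add_mul, mul_assoc]
  have hCr : x * casimir d (gen d) = casimirScalar d m • x := by
    rw [← hR.casimir_apply_of_e hxK hxf]
    simp [casimir, rightGen, pow_two, mul_add, mul_assoc]
  have hnm := PCompatible.casimirScalar_inj (T := LinearMap.mulLeft Qv (casimir d (gen d))) hx0 hCl
    ((commute_casimir x).eq.trans hCr)
  -- The reflected case `n + m = d - 1` contradicts `2n ≥ d` and `2m ≥ d`.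
  obtain rfl : n = m := by omega
  obtain ⟨hn0, hnd⟩ := hL.weight_mem_range (x := x) hxK' hx0
  obtain ⟨i, rfl⟩ := Int.eq_ofNat_of_zero_le hn0
  obtain ⟨p, hp⟩ := exists_isProjectors d
  obtain ⟨u, a, hu, hxu⟩ := exists_eq_f_mul_add hp (x := x) hxK' hxK
  obtain ⟨w, hw0, hwK, hwe⟩ := exists_highest_vector d i (d - i) (by omega) (by omega)
  have hgen : ∀ y, toEnd d (gen d y) = powGen d y := lift_gen _ _
  have hpw : toEnd d (p i) w = w := by
    have hj : ∀ j ∈ Finset.range (d + 1), j ≠ i → toEnd d (p j) w = 0 := fun j _ hji => by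
      have h1 : v ^ j • toEnd d (p j) w = v ^ i • toEnd d (p j) w := by
        rw [← LinearMap.smul_apply, ← map_smul, ← hp.mul_K₁, map_mul, Module.End.mul_apply, hgen]
        change toEnd d (p j) (ρpow d U.K₁ w) = _
        rw [hwK, map_smul]
      by_contra h0
      exact hji (v_pow_injective (smul_left_injective Qv h0 h1))
    have h1 : toEnd d (∑ j ∈ Finset.range (d + 1), p j) w = w := by
      rw [hp.sum_eq_one, map_one, Module.End.one_apply]
    rwa [map_sum, LinearMap.sum_apply,
      Finset.sum_eq_single_of_mem i (Finset.mem_range.2 (by omega)) hj] at h1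
  -- `x` lies in the kernel, hence kills `w`.
  have hact : powGen d .f (toEnd d u w) + a • w = 0 := by
    have := congrArg (· w) ((hJ' x).1 hxJ)
    rw [hxu] at this
    simpa [hgen, hpw] using this
  -- `u w` has weight `i + 1`, above the middle, and `e f u w = -a e w = 0`.
  have huw : toEnd d u w = 0 := by
    refine hV.eq_zero_of_e_f (n := (i : ℤ) + 1) ?_ (by omega) ?_
    · rw [← hgen, ← Module.End.mul_apply, ← map_mul, hu, map_smul, LinearMap.smul_apply]
    · have h1 : powGen d .e w = 0 := hwe
      rw [eq_neg_of_add_eq_zero_left hact, map_neg, map_smul, h1, smul_zero, neg_zero]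
  have ha : a = 0 := by
    rw [huw, map_zero, zero_add] at hact
    exact (smul_eq_zero.1 hact).resolve_right hw0
  rw [ha, zero_smul, add_zero] at hxu
  -- The same injectivity of `e f`, now for left multiplication on the algebra itself.
  have hu0 : u = 0 := hL.eq_zero_of_e_f (n := (i : ℤ) + 1) (x := u) hu (by omega) (by
    change gen d .e * (gen d .f * u) = 0
    rw [← hxu, hxe])
  exact hx0 (by rw [hxu, hu0, mul_zero])

/-- `K₂` and its inverse add nothing to the image: they act as scalar multiples of `K₁'` and `K₁`.
-/
theorem range_toEnd (d : ℕ) : (toEnd d).range = schur d := by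
  have hgen : ∀ y, toEnd d (gen d y) = powGen d y := lift_gen _ _
  apply le_antisymm
  · rw [← Algebra.map_top, ← adjoin_range_gen, AlgHom.map_adjoin, Algebra.adjoin_le_iff]
    rintro _ ⟨_, ⟨y, rfl⟩, rfl⟩
    refine Eq.subst (motive := (· ∈ schur d)) (hgen y).symm ?_
    cases y <;> exact ⟨_, rfl⟩
  · rw [schur, ← Algebra.map_top, ← U.adjoin_range_gen, AlgHom.map_adjoin, Algebra.adjoin_le_iff]
    rintro _ ⟨_, ⟨y, rfl⟩, rfl⟩
    cases y
    · exact ⟨_, hgen .e⟩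
    · exact ⟨_, hgen .f⟩
    · exact ⟨_, hgen .K₁⟩
    · exact ⟨_, hgen .K₁'⟩
    · exact ⟨v ^ d • gen d .K₁', by
        change toEnd d _ = _
        rw [map_smul, hgen]; exact (ρpow_K₂ d).symm⟩
    · exact ⟨(v ^ d)⁻¹ • gen d .K₁, by
        change toEnd d _ = _
        rw [map_smul, hgen]; exact (ρpow_K₂' d).symm⟩

end Presented

end QSchur

end

theorem theorem2p2 (d : ℕ) :
    ∃ φ : QSchur.Presented d ≃ₐ[QSchur.Qv] QSchur.schur d,
      φ (QSchur.Presented.gen d .e) = QSchur.toSchur d QSchur.U.e ∧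
      φ (QSchur.Presented.gen d .f) = QSchur.toSchur d QSchur.U.f ∧
      φ (QSchur.Presented.gen d .K₁) = QSchur.toSchur d QSchur.U.K₁ ∧
      φ (QSchur.Presented.gen d .K₁') = QSchur.toSchur d QSchur.U.K₁' ∧
      φ (QSchur.v ^ d • QSchur.Presented.gen d .K₁') = QSchur.toSchur d QSchur.U.K₂ := by
  let φ := (AlgEquiv.ofInjective (QSchur.Presented.toEnd d)
    (QSchur.Presented.toEnd_injective d)).trans
      (Subalgebra.equivOfEq _ _ (QSchur.Presented.range_toEnd d))
  have hφ : ∀ x, (φ x : Module.End QSchur.Qv _) = QSchur.Presented.toEnd d x := fun _ => rfl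
  have hg : ∀ y, QSchur.Presented.toEnd d (QSchur.Presented.gen d y) = QSchur.powGen d y :=
    QSchur.Presented.lift_gen _ _
  refine ⟨φ, Subtype.ext ?_, Subtype.ext ?_, Subtype.ext ?_, Subtype.ext ?_, Subtype.ext ?_⟩
  · exact (hφ _).trans (hg _)
  · exact (hφ _).trans (hg _)
  · exact (hφ _).trans (hg _)
  · exact (hφ _).trans (hg _)
  · rw [hφ, map_smul, hg]
    exact (QSchur.ρpow_K₂ d).symm
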